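/- Fix integers $m\ge 3$ and $d\ge 8$, and identify $\mathbb{K}[x_0,\dots,x_m]_d$ ($\mathbb{K}=\mathbb{R}$ or $\mathbb{C}$), the space of homogeneous polynomials of degree $d$, with $\mathbb{K}^{\binom{m+d}{m}}$ through coefficients. The real symmetric rank $r_{\mathbb{R}}(f)$ of $f\in\mathbb{R}[x_0,\dots,x_m]_d$ is the least $s$ such that $f=c_1\ell_1^d+\dots+c_s\ell_s^d$ with $c_i\in\mathbb{R}$ and real linear forms $\ell_i$. For $b\ge1$ let $\widehat{\sigma}_b\subset\mathbb{C}[x_0,\dots,x_m]_d$ be the closure of the set of all sums $c_1\ell_1^d+\dots+c_b\ell_b^d$ with $c_i\in\mathbb{C}$ and complex linear forms $\ell_i$ (the affine cone over the secant variety $\sigma_b(X_{m,d}(\mathbb{C}))$ of the Veronese variety $X_{m,d}(\mathbb{C})$), and let $\widehat{\sigma}_b(\mathbb{R})=\widehat{\sigma}_b\cap\mathbb{R}[x_0,\dots,x_m]_d$, the affine cone over $\sigma_b(X_{m,d}(\mathbb{C}))(\mathbb{R})$. An integer $r$ is called a typical rank of $\sigma_b(X_{m,d}(\mathbb{C}))(\mathbb{R})$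 if there is a non-empty subset $U$ of $\widehat{\sigma}_b(\mathbb{R})$, open in $\widehat{\sigma}_b(\mathbb{R})$ for the euclidean topology, that is an embedded smooth submanifold of real dimension $b(m+1)$ of $\mathbb{R}[x_0,\dots,x_m]_d$ (equivalently, its image in projective space has dimension $b(m+1)-1$) and such that $r_{\mathbb{R}}(f)=r$ for all $f\in U$. **Theorem.** For all integers $m\ge 3$ and $d\ge 8$ the set of typical ranks of $\sigma_4(X_{m,d}(\mathbb{C}))(\mathbb{R})$ is exactly $\{4,\ d+2,\ 2d\}$. -/

import Mathlib

open scoped ContDiff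

/-- The exponents of the monomials of degree `d` in the variables `x_0, …, x_m`. -/
abbrev MonomialExp (m d : ℕ) : Type :=
  {k : Fin (m + 1) →₀ ℕ // k ∈ Finset.finsuppAntidiag (Finset.univ : Finset (Fin (m + 1))) d}

/-- The form of degree `d` in `x_0, …, x_m` with coefficient vector `v`. This identifies
`K[x_0, …, x_m]_d` with the space `MonomialExp m d → K`, which carries the euclidean topology
when `K` is the real or the complex field. -/
noncomputable def formOfCoeffs {K : Type*} [CommSemiring K] {m d : ℕ}
    (v : MonomialExp m d → K) : MvPolynomial (Fin (m + 1)) K :=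
  ∑ k : MonomialExp m d, MvPolynomial.monomial k.1 (v k)

/-- `f = c_1 ℓ_1 ^ d + ⋯ + c_s ℓ_s ^ d` with scalars `c_i` and linear forms `ℓ_i` over `K`. -/
def IsSumOfPowers {K : Type*} [CommSemiring K] {m : ℕ} (d s : ℕ)
    (f : MvPolynomial (Fin (m + 1)) K) : Prop :=
  ∃ (c : Fin s → K) (l : Fin s → MvPolynomial (Fin (m + 1)) K),
    (∀ i, (l i).IsHomogeneous 1) ∧ f = ∑ i, MvPolynomial.C (c i) * l i ^ d

/-- The symmetric tensor rank of the form `f` of degree `d` with respect to `K` is `r`. -/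
def HasSymmRank {K : Type*} [CommSemiring K] {m : ℕ} (d : ℕ)
    (f : MvPolynomial (Fin (m + 1)) K) (r : ℕ) : Prop :=
  IsLeast {s : ℕ | IsSumOfPowers d s f} r

/-- The affine cone over `σ_b(X_{m,d}(ℂ))`: the closure of the union of the linear spans of
at most `b` points of the Veronese variety, that is, of the sums of `b` scalar multiples of
`d`-th powers of complex linear forms. -/
def secantCone (m d b : ℕ) : Set (MonomialExp m d → ℂ) :=
  closure {v | IsSumOfPowers d b (formOfCoeffs v)}

/-- The affine cone over `σ_b(X_{m,d}(ℂ))(ℝ)`: the real forms that lie in `secantCone m d b`. -/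
def realSecantCone (m d b : ℕ) : Set (MonomialExp m d → ℝ) :=
  {v | (fun k => (v k : ℂ)) ∈ secantCone m d b}

/-- `U` is an embedded smooth submanifold of dimension `n` of the normed space `E`: around each
of its points it has a parametrization by an open subset `V` of `ℝⁿ` that is a smooth immersion
and a homeomorphism onto its image, a neighbourhood `U ∩ O` of the point in `U`. -/
def IsSmoothSubmanifold {E : Type*} [NormedAddCommGroup E] [NormedSpace ℝ E]
    (n : ℕ) (U : Set E) : Prop :=
  ∀ p ∈ U, ∃ (O : Set E) (V : Set (EuclideanSpace ℝ (Fin n))) (φ : EuclideanSpace ℝ (Fin n) → E),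
    IsOpen O ∧ p ∈ O ∧ IsOpen V ∧ ContDiffOn ℝ ∞ φ V ∧
      (∀ x ∈ V, Function.Injective (fderiv ℝ φ x)) ∧
      Topology.IsEmbedding (V.domRestrict φ) ∧ φ '' V = U ∩ O

/-- `r` is a typical rank of `σ_b(X_{m,d}(ℂ))(ℝ)`: some non-empty (euclidean) open part of
`σ_b(X_{m,d}(ℂ))(ℝ)` is a manifold of dimension `b(m+1) - 1` all of whose points have real
symmetric rank `r`. On the affine cone the dimension is `b(m+1)`. -/
def IsTypicalRank (m d b r : ℕ) : Prop :=
  ∃ U : Set (MonomialExp m d → ℝ), U.Nonempty ∧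
    (∃ O : Set (MonomialExp m d → ℝ), IsOpen O ∧ U = realSecantCone m d b ∩ O) ∧
    IsSmoothSubmanifold (b * (m + 1)) U ∧
    ∀ v ∈ U, HasSymmRank d (formOfCoeffs v) r

/-! A general point of the cone is a sum of four powers of linear forms. If the point is real,
complex conjugation permutes the four summands, so they comprise four real ones, two real ones and a
conjugate pair, or two conjugate pairs. The typical ranks are the real ranks of these three
configurations when the four linear forms are independent.

Upper bounds: a conjugate pair of `d`-th powers is a combination of `d` real powers, by averaging
over roots of unity (`conj_pair_eq_sum_powers`). This gives `4`, `d + 2` and `2 * d`.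

Lower bounds: suppose the form is also a combination of real powers. Differentiating in a real
direction orthogonal to one or two of the real forms lowers the degree by one and removes their
terms. If the direction is orthogonal to none of the four given forms, all four powers survive with
nonzero weights. With one conjugate pair, one real term can be removed per derivative; with two
pairs, two terms. The induction ends in degree two, where four powers of independent forms are not a
combination of three (`four_powers_ne_three`).

Geometry: four points are described by the roots of a quartic (their coordinate `x_1` when `x_0 =
1`), by cubics that interpolate the other coordinates, and by the first four moments of the weights.
This gives a polynomial map `secantParam` on a space of dimension `4 * (m + 1)`, defined even where
the quartic has multiple roots. Where a 4 by 4 Hankel determinant does not vanish, its parameter is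
recovered from the form by linear algebra (`paramOf`), so the map is an immersion and an embedding
onto an open part of the real cone. The root type is locally constant on quartics with simple roots
and all three types occur on open sets, so the three numbers are typical ranks.

Conversely, an open piece of full dimension cannot lie in the zero locus of the Hankel determinant
(`exists_det_hankel_ne_zero`), since any `4 * (m + 1)` linear functions are algebraically dependent
there. It therefore contains parametrized points, and after a small perturbation one with simple
roots and independent forms, whose rank is one of the three. -/

/-! ### Coefficient vectors of sums of powers -/

section PowerSums

open MvPolynomial

variable {K : Type*} [CommSemiring K] {m d : ℕ} {ι : Type*} [Fintype ι]

/-- The coefficient vector of the form `∑ i, w i * (∑ j, a i j * x_j) ^ d`. -/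
noncomputable def powerSum (d : ℕ) (w : ι → K) (a : ι → Fin (m + 1) → K) : MonomialExp m d → K :=
  fun α => α.1.multinomial * ∑ i, w i * ∏ j, a i j ^ α.1 j

theorem MonomialExp.sum_eq (α : MonomialExp m d) : ∑ j, α.1 j = d :=
  (Finset.mem_finsuppAntidiag.1 α.2).1

theorem coeff_formOfCoeffs (v : MonomialExp m d → K) (k : Fin (m + 1) →₀ ℕ) :
    coeff k (formOfCoeffs v) = if h : k ∈ Finset.finsuppAntidiag Finset.univ d
      then v ⟨k, h⟩ else 0 := by
  classical
  simp only [formOfCoeffs, coeff_sum, coeff_monomial]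
  split_ifs with h
  · rw [Finset.sum_eq_single ⟨k, h⟩]
    · simp
    · intro b _ hb
      exact if_neg fun h' => hb (Subtype.ext h')
    · simp
  · refine Finset.sum_eq_zero fun b _ => if_neg ?_
    rintro rfl
    exact h b.2

theorem formOfCoeffs_injective :
    Function.Injective (formOfCoeffs : (MonomialExp m d → K) → MvPolynomial (Fin (m + 1)) K) := by
  intro v v' h
  ext k
  have := congrArg (coeff k.1) h
  simpa [coeff_formOfCoeffs, k.2] using this

theorem formOfCoeffs_powerSum (w : ι → K) (a : ι → Fin (m + 1) → K) :
    formOfCoeffs (powerSum d w a) =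
      ∑ i, C (w i) * (∑ j, a i j • (X j : MvPolynomial (Fin (m + 1)) K)) ^ d := by
  ext k
  simp only [coeff_formOfCoeffs, coeff_sum, coeff_C_mul, coeff_linearCombination_X_pow_of_fintype]
  have hk : k.sum (fun _ e => e) = ∑ j, k j := Finsupp.sum_fintype _ _ (by simp)
  simp only [hk, Finset.mem_finsuppAntidiag, Finset.subset_univ, and_true, powerSum]
  split_ifs with h
  · rw [Finset.mul_sum]
    refine Finset.sum_congr rfl fun i _ => ?_
    rw [Finsupp.prod_fintype _ _ (by simp)]
    ring
  · simp

theorem exists_linear_of_isHomogeneous_one {l : MvPolynomial (Fin (m + 1)) K}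
    (h : l.IsHomogeneous 1) : ∃ a : Fin (m + 1) → K, l = ∑ j, a j • X j := by
  classical
  refine ⟨fun j => coeff (Finsupp.single j 1) l, ?_⟩
  ext k
  simp only [coeff_sum, coeff_smul, coeff_X, smul_eq_mul, mul_ite, mul_one, mul_zero]
  by_cases hk : k.degree = 1
  · obtain ⟨j, rfl⟩ := (Finsupp.sum_eq_one_iff k).1 hk
    rw [Finset.sum_eq_single j] <;> simp +contextual [Finsupp.single_left_inj]
  · rw [h.coeff_eq_zero hk, Finset.sum_eq_zero]
    intro j _
    rw [if_neg]
    rintro rfl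
    simp at hk

theorem isSumOfPowers_formOfCoeffs_iff {s : ℕ} {v : MonomialExp m d → K} :
    IsSumOfPowers d s (formOfCoeffs v) ↔
      ∃ (w : Fin s → K) (a : Fin s → Fin (m + 1) → K), v = powerSum d w a := by
  constructor
  · rintro ⟨c, l, hl, h⟩
    choose a ha using fun i => exists_linear_of_isHomogeneous_one (hl i)
    refine ⟨c, a, formOfCoeffs_injective ?_⟩
    rw [h, formOfCoeffs_powerSum]
    simp only [ha]
  · rintro ⟨w, a, rfl⟩
    refine ⟨w, fun i => ∑ j, a i j • X j, fun i => ?_, formOfCoeffs_powerSum w a⟩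
    refine IsHomogeneous.sum _ _ _ fun j _ => ?_
    rw [smul_eq_C_mul]
    exact (isHomogeneous_X K j).C_mul _

theorem eval_formOfCoeffs_powerSum (w : ι → K) (a : ι → Fin (m + 1) → K) (x : Fin (m + 1) → K) :
    eval x (formOfCoeffs (powerSum d w a)) = ∑ i, w i * (a i ⬝ᵥ x) ^ d := by
  simp [formOfCoeffs_powerSum, dotProduct, smul_eval]

theorem map_powerSum {L : Type*} [CommSemiring L] (f : K →+* L) (w : ι → K)
    (a : ι → Fin (m + 1) → K) (α : MonomialExp m d) :
    f (powerSum d w a α) = powerSum d (f ∘ w) (fun i => f ∘ a i) α := by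
  simp [powerSum, map_sum, map_prod]

/-- Over an infinite field a form is determined by its values, so identities between sums of powers
may be checked pointwise. -/
theorem powerSum_eq_of_forall_eq {K : Type*} [Field K] [Infinite K] {ι κ : Type*} [Fintype ι]
    [Fintype κ] {w : ι → K} {a : ι → Fin (m + 1) → K} {c : κ → K} {b : κ → Fin (m + 1) → K}
    (h : ∀ x, ∑ i, w i * (a i ⬝ᵥ x) ^ d = ∑ i, c i * (b i ⬝ᵥ x) ^ d) :
    powerSum d w a = powerSum d c b :=
  formOfCoeffs_injective (MvPolynomial.funext fun x => by
    simpa only [eval_formOfCoeffs_powerSum] using h x)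

end PowerSums

/-! ### Lower bounds for the number of real powers, by differentiation -/

section RealPowers

variable {n κ : Type*} [Fintype n]

theorem hasDerivAt_sum_powers {ι : Type*} (s : Finset ι) (u : ι → ℂ) (f : ι → n → ℂ) (k : ℕ)
    (D x : n → ℂ) :
    HasDerivAt (fun t : ℂ => ∑ i ∈ s, u i * (f i ⬝ᵥ (x + t • D)) ^ (k + 1))
      ((k + 1) * ∑ i ∈ s, u i * (f i ⬝ᵥ D) * (f i ⬝ᵥ x) ^ k) 0 := by
  rw [Finset.mul_sum]
  refine HasDerivAt.fun_sum fun i _ => ?_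
  have h1 : HasDerivAt (fun t : ℂ => f i ⬝ᵥ x + t * (f i ⬝ᵥ D)) (1 * (f i ⬝ᵥ D)) 0 :=
    ((hasDerivAt_id (0 : ℂ)).mul_const _).const_add _
  have h2 := (h1.fun_pow (k + 1)).const_mul (u i)
  simp only [dotProduct_add, dotProduct_smul, smul_eq_mul]
  convert! h2 using 1
  simp
  ring

/-- Differentiating an identity between sums of powers of linear forms in the direction `D`. -/
theorem sum_powers_directional_derivative {k : ℕ} {ι : Type*} {I : Finset ι} {J : Finset κ}
    {w : ι → ℂ} {a : ι → n → ℂ} {c : κ → ℂ} {b : κ → n → ℂ}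
    (h : ∀ x, ∑ i ∈ I, w i * (a i ⬝ᵥ x) ^ (k + 1) = ∑ j ∈ J, c j * (b j ⬝ᵥ x) ^ (k + 1))
    (D x : n → ℂ) :
    ∑ i ∈ I, w i * (a i ⬝ᵥ D) * (a i ⬝ᵥ x) ^ k =
      ∑ j ∈ J, c j * (b j ⬝ᵥ D) * (b j ⬝ᵥ x) ^ k := by
  have h1 := hasDerivAt_sum_powers I w a k D x
  simp only [h] at h1
  exact mul_left_cancel₀ (by exact_mod_cast Nat.succ_ne_zero k)
    (h1.unique (hasDerivAt_sum_powers J c b k D x))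

/-- Removing from a sum of powers the terms killed by a differentiation. -/
theorem sum_powers_derivative_sdiff {k : ℕ} [DecidableEq κ] {J B : Finset κ} (hB : B ⊆ J)
    {w : Fin 4 → ℂ} {a : Fin 4 → n → ℂ} {c : κ → ℂ} {b : κ → n → ℂ}
    (h : ∀ x, ∑ i, w i * (a i ⬝ᵥ x) ^ (k + 1) = ∑ j ∈ J, c j * (b j ⬝ᵥ x) ^ (k + 1))
    {D : n → ℂ} (hD : ∀ j ∈ B, b j ⬝ᵥ D = 0) (x : n → ℂ) :
    ∑ i, w i * (a i ⬝ᵥ D) * (a i ⬝ᵥ x) ^ k =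
      ∑ j ∈ J \ B, c j * (b j ⬝ᵥ D) * (b j ⬝ᵥ x) ^ k := by
  rw [sum_powers_directional_derivative h D x, ← Finset.sum_sdiff hB, add_eq_left]
  exact Finset.sum_eq_zero fun j hj => by simp [hD j hj]

/-- Four powers of independent linear forms are not a sum of three powers. -/
theorem four_powers_ne_three {k : ℕ} {J : Finset κ} (hJ : J.card ≤ 3)
    {w : Fin 4 → ℂ} (hw : ∀ i, w i ≠ 0) {a e : Fin 4 → n → ℂ}
    (he : ∀ i j, a i ⬝ᵥ e j = if i = j then 1 else 0) {c : κ → ℂ} {b : κ → n → ℂ}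
    (h : ∀ x, ∑ i, w i * (a i ⬝ᵥ x) ^ (k + 2) = ∑ j ∈ J, c j * (b j ⬝ᵥ x) ^ (k + 2)) :
    False := by
  classical
  -- At most three linear conditions on four unknowns: some nonzero combination `D` of the `e i` is
  -- orthogonal to every `b j`. The derivative along `D` kills the right side, and its value at `e
  -- i` isolates the `i`-th coordinate of `D`.
  let T : (Fin 4 → ℂ) →ₗ[ℂ] (J → ℂ) := LinearMap.pi fun j =>
    ∑ i, (b j ⬝ᵥ e i) • LinearMap.proj i
  have hT : T.ker ≠ ⊥ := LinearMap.ker_ne_bot_of_finrank_lt (by simpa using Nat.lt_succ_of_le hJ)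
  obtain ⟨y, hy, hy0⟩ := Submodule.exists_mem_ne_zero_of_ne_bot hT
  refine hy0 (funext fun i => ?_)
  have hD : ∀ j ∈ J, b j ⬝ᵥ (∑ i, y i • e i) = 0 := fun j hj => by
    have := congrFun (LinearMap.mem_ker.1 hy) ⟨j, hj⟩
    simp only [T, LinearMap.pi_apply, LinearMap.sum_apply, LinearMap.smul_apply,
      LinearMap.proj_apply, smul_eq_mul, Pi.zero_apply] at this
    simpa [dotProduct_sum, mul_comm] using this
  have haD : ∀ i, a i ⬝ᵥ (∑ i, y i • e i) = y i := fun i => by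
    simp [dotProduct_sum, he]
  have h1 := sum_powers_derivative_sdiff (k := k + 1) subset_rfl h hD (e i)
  simpa [he, haD, hw i, ite_pow] using h1

/-- A vector that every real direction orthogonal to the real vectors `b j` annihilates is in their
complex span. -/
theorem mem_span_of_forall_real [DecidableEq κ] {B : Finset κ} {b : κ → n → ℝ} {a : n → ℂ}
    (h : ∀ D : n → ℝ, (∀ j ∈ B, b j ⬝ᵥ D = 0) → a ⬝ᵥ (Complex.ofReal ∘ D) = 0) :
    a ∈ Submodule.span ℂ (B.image fun j => Complex.ofReal ∘ b j : Set (n → ℂ)) := by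
  classical
  have hC : ∀ D : n → ℂ, (∀ j ∈ B, (Complex.ofReal ∘ b j) ⬝ᵥ D = 0) → a ⬝ᵥ D = 0 := by
    intro D hD
    have hre := h (fun t => (D t).re) fun j hj => by
      simpa [dotProduct] using congrArg Complex.re (hD j hj)
    have him := h (fun t => (D t).im) fun j hj => by
      simpa [dotProduct] using congrArg Complex.im (hD j hj)
    have hsplit : D = (Complex.ofReal ∘ fun t => (D t).re) +
        Complex.I • (Complex.ofReal ∘ fun t => (D t).im) := by
      ext t
      simp [mul_comm Complex.I, Complex.re_add_im]
    rw [hsplit, dotProduct_add, dotProduct_smul, hre, him]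
    simp
  have key := mem_span_of_iInf_ker_le_ker
    (L := fun j : B => dotProductBilin ℂ ℂ (Complex.ofReal ∘ b j))
    (K := dotProductBilin ℂ ℂ a) (fun D hD => by
      simp only [Submodule.mem_iInf, LinearMap.mem_ker] at hD ⊢
      exact hC D fun j hj => hD ⟨j, hj⟩)
  obtain ⟨c, hc⟩ := (Submodule.mem_span_range_iff_exists_fun ℂ).1 key
  have ha : a = ∑ j : B, c j • (Complex.ofReal ∘ b j) := by
    ext t
    have := LinearMap.congr_fun hc (Pi.single t 1)
    simpa using this.symm
  rw [ha]
  refine Submodule.sum_mem _ fun j _ => Submodule.smul_mem _ _ (Submodule.subset_span ?_)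
  simpa using ⟨j.1, j.2, rfl⟩

/-- A real direction that is orthogonal to the real vectors `b j` and to none of the complex
vectors `a i` outside their span. -/
theorem exists_real_direction [DecidableEq κ] {ι : Type*} [Finite ι] {B : Finset κ}
    {b : κ → n → ℝ} {a : ι → n → ℂ}
    (h : ∀ i, a i ∉ Submodule.span ℂ (B.image fun j => Complex.ofReal ∘ b j : Set (n → ℂ))) :
    ∃ D : n → ℝ, (∀ j ∈ B, b j ⬝ᵥ D = 0) ∧ ∀ i, a i ⬝ᵥ (Complex.ofReal ∘ D) ≠ 0 := by
  let N : Submodule ℝ (n → ℝ) := ⨅ j ∈ B, LinearMap.ker (dotProductBilin ℝ ℝ (b j))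
  have hN : ∀ D, D ∈ N ↔ ∀ j ∈ B, b j ⬝ᵥ D = 0 := fun D => by
    simp [N, Submodule.mem_iInf]
  let φ : ι → N →ₗ[ℝ] ℂ := fun i =>
    { toFun := fun D => a i ⬝ᵥ (Complex.ofReal ∘ D.1)
      map_add' := fun x y => by
        rw [← dotProduct_add]; congr 1; ext; simp
      map_smul' := fun r x => by
        rw [RingHom.id_apply, Complex.real_smul, ← smul_eq_mul, ← dotProduct_smul]
        congr 1; ext; simp }
  -- Otherwise the real space of directions orthogonal to the `b j` would be a finite union of the
  -- kernels of the functionals `φ i`; over an infinite field one kernel is then everything.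
  by_contra! hcon
  have hcover : ⋃ i, ((φ i).ker : Set N) = Set.univ := by
    refine Set.eq_univ_of_forall fun D => ?_
    obtain ⟨i, hi⟩ := hcon D.1 ((hN _).1 D.2)
    exact Set.mem_iUnion.2 ⟨i, hi⟩
  obtain ⟨i, hi⟩ := Subspace.exists_eq_top_of_iUnion_eq_univ hcover
  refine h i (mem_span_of_forall_real fun D hD => ?_)
  have : (⟨D, (hN D).2 hD⟩ : N) ∈ (φ i).ker := hi ▸ Submodule.mem_top
  exact this

/-- The spanning vectors are real, so their complex span is stable under conjugation. Hence such a
span contains both members of a conjugate pair or neither. -/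
theorem star_mem_span_real [DecidableEq κ] {B : Finset κ} {b : κ → n → ℝ} {a : n → ℂ}
    (h : a ∈ Submodule.span ℂ (B.image fun j => Complex.ofReal ∘ b j : Set (n → ℂ))) :
    star a ∈ Submodule.span ℂ (B.image fun j => Complex.ofReal ∘ b j : Set (n → ℂ)) := by
  induction h using Submodule.span_induction with
  | mem x hx =>
    have : star x = x := by
      obtain ⟨j, _, rfl⟩ := Finset.mem_image.1 (Finset.mem_coe.1 hx)
      ext; simp
    rw [this]
    exact Submodule.subset_span hx
  | zero => simp
  | add x y _ _ hx hy => rw [star_add]; exact add_mem hx hy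
  | smul r x _ hx => rw [star_smul]; exact Submodule.smul_mem _ _ hx

variable {w : Fin 4 → ℂ} {a e : Fin 4 → n → ℂ} {b : κ → n → ℝ}

/-- Two powers and a complex conjugate pair of powers, all of independent linear forms, of degree
`k + 2` are not a sum of `k + 3` powers of real linear forms. -/
theorem one_conj_pair_ne_real_powers [DecidableEq κ]
    (he : ∀ i j, a i ⬝ᵥ e j = if i = j then 1 else 0) (h23 : a 3 = star (a 2)) (k : ℕ)
    {J : Finset κ} (hJ : J.card ≤ k + 3) (hw : ∀ i, w i ≠ 0) {c : κ → ℂ}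
    (h : ∀ x, ∑ i, w i * (a i ⬝ᵥ x) ^ (k + 2) =
      ∑ j ∈ J, c j * ((Complex.ofReal ∘ b j) ⬝ᵥ x) ^ (k + 2)) : False := by
  have ha0 : ∀ i, a i ≠ 0 := fun i hi => by simpa [hi] using he i i
  induction k generalizing J w c with
  | zero => exact four_powers_ne_three hJ hw he h
  | succ k ih =>
    -- If every `b j` were proportional to `a 0` or `a 1`, the right side would vanish at `e 2`,
    -- where the left side equals `w 2`.
    obtain ⟨j, hj, hj0, hj1⟩ : ∃ j ∈ J, Complex.ofReal ∘ b j ∉ Submodule.span ℂ {a 0} ∧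
        Complex.ofReal ∘ b j ∉ Submodule.span ℂ {a 1} := by
      by_contra! hcon
      have hz : ∀ j ∈ J, (Complex.ofReal ∘ b j) ⬝ᵥ e 2 = 0 := fun j hj => by
        by_cases h0 : Complex.ofReal ∘ b j ∈ Submodule.span ℂ {a 0}
        · obtain ⟨r, hr⟩ := Submodule.mem_span_singleton.1 h0
          simp [← hr, he]
        · obtain ⟨r, hr⟩ := Submodule.mem_span_singleton.1 (hcon j hj h0)
          simp [← hr, he]
      have := (h (e 2)).trans (Finset.sum_eq_zero fun j hj => by rw [hz j hj]; simp)
      simp [he, ite_pow, hw] at this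
    have hnot : ∀ i, a i ∉ Submodule.span ℂ
        ((({j} : Finset κ).image fun j => Complex.ofReal ∘ b j : Finset _) : Set (n → ℂ)) := by
      have h01 : ∀ i, Complex.ofReal ∘ b j ∉ Submodule.span ℂ {a i} → a i ∉ Submodule.span ℂ
        ((({j} : Finset κ).image fun j => Complex.ofReal ∘ b j : Finset _) : Set (n → ℂ)) := by
        intro i hi hmem
        simp only [Finset.image_singleton, Finset.coe_singleton] at hmem
        obtain ⟨r, hr⟩ := Submodule.mem_span_singleton.1 hmem
        have hr0 : r ≠ 0 := fun h0 => ha0 i (by rw [← hr, h0, zero_smul])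
        exact hi (Submodule.mem_span_singleton.2 ⟨r⁻¹, by rw [← hr, inv_smul_smul₀ hr0]⟩)
      -- A line cannot contain two independent vectors. As the line is spanned by a real vector,
      -- containing one of `a 2`, `a 3` would force it to contain the other.
      have h2 : ¬ (a 2 ∈ Submodule.span ℂ
          ((({j} : Finset κ).image fun j => Complex.ofReal ∘ b j : Finset _) : Set (n → ℂ)) ∧
          a 3 ∈ Submodule.span ℂ
          ((({j} : Finset κ).image fun j => Complex.ofReal ∘ b j : Finset _) : Set (n → ℂ))) := by
        rintro ⟨h2, h3⟩
        simp only [Finset.image_singleton, Finset.coe_singleton] at h2 h3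
        obtain ⟨r, hr⟩ := Submodule.mem_span_singleton.1 h2
        obtain ⟨s, hs⟩ := Submodule.mem_span_singleton.1 h3
        have h22 := he 2 2
        have h33 := he 3 3
        have h32 := he 3 2
        rw [← hr, smul_dotProduct] at h22
        rw [← hs, smul_dotProduct] at h33 h32
        simp only [smul_eq_mul, if_true, Fin.reduceEq, if_false, mul_eq_zero] at h22 h33 h32
        rcases h32 with h32 | h32
        · simp [h32] at h33
        · simp [h32] at h22
      intro i
      fin_cases i
      · exact h01 0 hj0
      · exact h01 1 hj1
      · exact fun hmem => h2 ⟨hmem, h23 ▸ star_mem_span_real hmem⟩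
      · refine fun hmem => h2 ⟨?_, hmem⟩
        have := star_mem_span_real hmem
        simpa [h23] using this
    -- The derivative along `D` lowers the degree and the number of real terms by one and multiplies
    -- each `w i` by the nonzero number `a i ⬝ᵥ D`.
    obtain ⟨D, hD, hDa⟩ := exists_real_direction hnot
    refine ih (J := J \ {j}) ?_ (w := fun i => w i * (a i ⬝ᵥ (Complex.ofReal ∘ D)))
      (fun i => mul_ne_zero (hw i) (hDa i))
      (sum_powers_derivative_sdiff (by simpa using hj) h (D := Complex.ofReal ∘ D) ?_)
    · rw [Finset.card_sdiff_of_subset (by simpa using hj)]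
      simp
      omega
    · intro j hj
      have := congrArg Complex.ofReal (hD j hj)
      simpa [dotProduct] using this

/-- Two complex conjugate pairs of powers of independent linear forms of degree `k + 2` are not a
sum of `2 * k + 3` powers of real linear forms. -/
theorem two_conj_pairs_ne_real_powers [DecidableEq κ]
    (he : ∀ i j, a i ⬝ᵥ e j = if i = j then 1 else 0) (h01 : a 1 = star (a 0))
    (h23 : a 3 = star (a 2)) (k : ℕ) {J : Finset κ} (hJ : J.card ≤ 2 * k + 3)
    (hw : ∀ i, w i ≠ 0) {c : κ → ℂ}
    (h : ∀ x, ∑ i, w i * (a i ⬝ᵥ x) ^ (k + 2) =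
      ∑ j ∈ J, c j * ((Complex.ofReal ∘ b j) ⬝ᵥ x) ^ (k + 2)) : False := by
  have hli : ∀ i j, i ≠ j → LinearIndependent ℂ ![a i, a j] := fun i j hij => by
    rw [LinearIndependent.pair_iff]
    intro s t hst
    have h1 := congrArg (· ⬝ᵥ e i) hst
    have h2 := congrArg (· ⬝ᵥ e j) hst
    simpa [he, hij, hij.symm] using And.intro h1 h2
  induction k generalizing J w c with
  | zero => exact four_powers_ne_three hJ hw he h
  | succ k ih =>
    -- The real forms cannot all lie in the span of `a p` and `a q`: the right side would then
    -- vanish at `e r`, where the left side equals `w r`.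
    have hex : ∀ p q r : Fin 4, p ≠ r → q ≠ r →
        ∃ j ∈ J, Complex.ofReal ∘ b j ∉ Submodule.span ℂ {a p, a q} := by
      intro p q r hpr hqr
      by_contra! hcon
      have hz : ∀ j ∈ J, (Complex.ofReal ∘ b j) ⬝ᵥ e r = 0 := fun j hj => by
        obtain ⟨s, t, hst⟩ := Submodule.mem_span_pair.1 (hcon j hj)
        simp [← hst, he, hpr, hqr]
      have := (h (e r)).trans (Finset.sum_eq_zero fun j hj => by rw [hz j hj]; simp)
      simp [he, ite_pow, hw] at this
    obtain ⟨j₁, hj₁, hb₁⟩ := hex 0 1 2 (by decide) (by decide)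
    obtain ⟨j₂, hj₂, hb₂⟩ := hex 2 3 0 (by decide) (by decide)
    -- Two terms have to be removed even if `j₁ = j₂`, so the pair is padded inside `J`; the minimum
    -- covers the case where `J` has fewer than two elements.
    obtain ⟨B, hB₁, hBJ, hBc⟩ := Finset.exists_subsuperset_card_eq
      (s := {j₁, j₂}) (t := J) (n := min 2 J.card) (by grind)
      (le_min Finset.card_le_two (Finset.card_le_card (by grind))) (min_le_right _ _)
    -- If both `a p` and `a q` lay in the span of `B`, of dimension at most two, they would span it,
    -- and `b j` would lie in their span.
    have hpair : ∀ p q : Fin 4, p ≠ q → ∀ j ∈ B,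
        Complex.ofReal ∘ b j ∉ Submodule.span ℂ {a p, a q} →
        ¬ (a p ∈ Submodule.span ℂ (B.image fun j => Complex.ofReal ∘ b j : Set (n → ℂ)) ∧
          a q ∈ Submodule.span ℂ (B.image fun j => Complex.ofReal ∘ b j : Set (n → ℂ))) := by
      rintro p q hpq j hj hb ⟨hp, hq⟩
      refine hb ?_
      have hle : Submodule.span ℂ {a p, a q} ≤
          Submodule.span ℂ (B.image fun j => Complex.ofReal ∘ b j : Set (n → ℂ)) := by
        rw [Submodule.span_le]
        rintro x (rfl | rfl) <;> assumption
      have h2 : Module.finrank ℂ (Submodule.span ℂ {a p, a q}) = 2 := by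
        rw [← Matrix.range_cons_cons_empty (a p) (a q) ![]]
        simpa using finrank_span_eq_card (hli p q hpq)
      have h3 : Module.finrank ℂ
          (Submodule.span ℂ (B.image fun j => Complex.ofReal ∘ b j : Set (n → ℂ))) ≤ 2 :=
        ((finrank_span_finset_le_card _).trans Finset.card_image_le).trans
          (hBc.le.trans (min_le_left _ _))
      rw [Submodule.eq_of_le_of_finrank_le hle (h3.trans h2.ge)]
      exact Submodule.subset_span (Finset.mem_coe.2 (Finset.mem_image_of_mem _ hj))
    have hn01 := hpair 0 1 (by decide) j₁ (hB₁ (by simp)) hb₁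
    have hn23 := hpair 2 3 (by decide) j₂ (hB₁ (by simp)) hb₂
    have hnot : ∀ i, a i ∉ Submodule.span ℂ
        (B.image fun j => Complex.ofReal ∘ b j : Set (n → ℂ)) := by
      intro i
      fin_cases i
      · exact fun hm => hn01 ⟨hm, h01 ▸ star_mem_span_real hm⟩
      · exact fun hm => hn01 ⟨by simpa [h01] using star_mem_span_real hm, hm⟩
      · exact fun hm => hn23 ⟨hm, h23 ▸ star_mem_span_real hm⟩
      · exact fun hm => hn23 ⟨by simpa [h23] using star_mem_span_real hm, hm⟩
    obtain ⟨D, hD, hDa⟩ := exists_real_direction hnot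
    refine ih (J := J \ B) ?_ (w := fun i => w i * (a i ⬝ᵥ (Complex.ofReal ∘ D)))
      (fun i => mul_ne_zero (hw i) (hDa i))
      (sum_powers_derivative_sdiff hBJ h (D := Complex.ofReal ∘ D) ?_)
    · rw [Finset.card_sdiff_of_subset hBJ, hBc]
      omega
    · intro j hj
      have := congrArg Complex.ofReal (hD j hj)
      simpa [dotProduct] using this

end RealPowers

/-! ### Real ranks of the three conjugation types -/

section RealRank

/-- A conjugate pair of `d`-th powers is a combination of `d` powers of real binary forms. -/
theorem conj_pair_eq_sum_powers {d : ℕ} (hd : d ≠ 0) (w : ℂ) :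
    ∃ a : Fin d → ℂ, ∀ u u' : ℂ, w * u ^ d + star w * u' ^ d =
      ∑ k : Fin d, ((-1) ^ (k : ℕ) / d) * (a k * u + star (a k) * u') ^ d := by
  obtain ⟨a₀, ha₀⟩ : ∃ a₀ : ℂ, a₀ ^ d = w := IsAlgClosed.exists_pow_nat_eq w (Nat.pos_of_ne_zero hd)
  have hdC : (d : ℂ) ≠ 0 := by exact_mod_cast hd
  -- Since `ξ ^ d = -1`, the sign `(-1) ^ k` cancels the factor `ξ ^ (-k * d)` coming from the
  -- conjugate. The term with `u ^ j` then carries `(ξ ^ 2) ^ (j * k)`, and summing over `k` leaves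
  -- only `j = 0` and `j = d`.
  set ξ : ℂ := Complex.exp (Real.pi * Complex.I / d) with hξ
  have hξ0 : ξ ≠ 0 := Complex.exp_ne_zero _
  have hξd : ξ ^ d = -1 := by
    rw [hξ, ← Complex.exp_nat_mul, mul_div_cancel₀ _ hdC, Complex.exp_pi_mul_I]
  have hξs : star ξ = ξ⁻¹ := by
    rw [hξ, ← Complex.exp_neg, Complex.star_def, ← Complex.exp_conj]
    simp [neg_div]
  have hζ : IsPrimitiveRoot (ξ ^ 2) d := by
    have := Complex.isPrimitiveRoot_exp d hd
    convert this using 1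
    rw [hξ, ← Complex.exp_nat_mul]
    congr 1
    push_cast
    ring
  have hgeom : ∀ j, ∑ k : Fin d, ((ξ ^ 2) ^ j) ^ (k : ℕ) = if d ∣ j then (d : ℂ) else 0 := by
    intro j
    rw [Fin.sum_univ_eq_sum_range (fun k => ((ξ ^ 2) ^ j) ^ k)]
    split_ifs with hj
    · simp [(hζ.pow_eq_one_iff_dvd j).2 hj]
    · have h1 : (ξ ^ 2) ^ j ≠ 1 := fun h => hj ((hζ.pow_eq_one_iff_dvd j).1 h)
      have := geom_sum_mul ((ξ ^ 2) ^ j) d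
      rw [pow_right_comm (ξ ^ 2) j d, hζ.pow_eq_one, one_pow, sub_self] at this
      exact (mul_eq_zero.1 this).resolve_right (sub_ne_zero.2 h1)
  refine ⟨fun k => a₀ * ξ ^ (k : ℕ), fun u u' => ?_⟩
  have hterm : ∀ k : Fin d, ∀ j ∈ Finset.range (d + 1),
      (-1) ^ (k : ℕ) / (d : ℂ) * ((a₀ * ξ ^ (k : ℕ) * u) ^ j *
        (star (a₀ * ξ ^ (k : ℕ)) * u') ^ (d - j) * (d.choose j)) =
      (a₀ * u) ^ j * (star a₀ * u') ^ (d - j) * (d.choose j) / d * ((ξ ^ 2) ^ j) ^ (k : ℕ) := by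
    intro k j hj
    have hjd : j ≤ d := Nat.lt_succ_iff.1 (Finset.mem_range.1 hj)
    have h1 : (-1 : ℂ) ^ (k : ℕ) * (ξ ^ (k : ℕ)) ^ j * ((ξ⁻¹) ^ (k : ℕ)) ^ (d - j) =
        ((ξ ^ 2) ^ j) ^ (k : ℕ) := by
      rw [← hξd, inv_pow, inv_pow, ← pow_mul, ← pow_mul, ← pow_mul, ← pow_mul, ← pow_mul,
        mul_inv_eq_iff_eq_mul₀ (pow_ne_zero _ hξ0), ← pow_add, ← pow_add]
      congr 1
      obtain ⟨i, rfl⟩ := Nat.exists_eq_add_of_le hjd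
      rw [Nat.add_sub_cancel_left]
      ring
    rw [← h1, star_mul', star_pow, hξs]
    simp only [mul_pow]
    ring
  symm
  calc _ = ∑ k : Fin d, ∑ j ∈ Finset.range (d + 1),
        (a₀ * u) ^ j * (star a₀ * u') ^ (d - j) * (d.choose j) / d * ((ξ ^ 2) ^ j) ^ (k : ℕ) := by
        refine Finset.sum_congr rfl fun k _ => ?_
        rw [add_pow, Finset.mul_sum]
        exact Finset.sum_congr rfl (hterm k)
    _ = ∑ j ∈ Finset.range (d + 1), (a₀ * u) ^ j * (star a₀ * u') ^ (d - j) * (d.choose j) / d *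
        (if d ∣ j then (d : ℂ) else 0) := by
        rw [Finset.sum_comm]
        exact Finset.sum_congr rfl fun j _ => by rw [← Finset.mul_sum, hgeom]
    _ = _ := by
        rw [Finset.sum_eq_add 0 d (Ne.symm hd)]
        · rw [← ha₀]
          simp [hdC, mul_pow]
          ring
        · intro j hj hj0
          have : ¬ d ∣ j := fun h => hj0.2 (le_antisymm
            (Nat.lt_succ_iff.1 (Finset.mem_range.1 hj)) (Nat.le_of_dvd (Nat.pos_of_ne_zero hj0.1) h))
          simp [this]
        · simp
        · simp

variable {m d : ℕ}

theorem exists_real_powers_of_conj_pair (hd : d ≠ 0) (w : ℂ) (a : Fin (m + 1) → ℂ) :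
    ∃ (c : Fin d → ℝ) (b : Fin d → Fin (m + 1) → ℝ), ∀ x,
      w * (a ⬝ᵥ x) ^ d + star w * (star a ⬝ᵥ x) ^ d =
        ∑ k, (c k : ℂ) * ((Complex.ofReal ∘ b k) ⬝ᵥ x) ^ d := by
  obtain ⟨z, hz⟩ := conj_pair_eq_sum_powers hd w
  refine ⟨fun k => (-1) ^ (k : ℕ) / d, fun k j => 2 * (z k * a j).re, fun x => ?_⟩
  rw [hz]
  refine Finset.sum_congr rfl fun k _ => ?_
  have : (Complex.ofReal ∘ fun j => 2 * (z k * a j).re) = z k • a + star (z k) • star a := by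
    ext j
    have := Complex.add_conj (z k * a j)
    simp only [Function.comp, Pi.add_apply, Pi.smul_apply, smul_eq_mul, Pi.star_apply]
    rw [← star_mul', Complex.star_def, this]
  rw [this, add_dotProduct, smul_dotProduct, smul_dotProduct]
  simp

theorem exists_real_power_of_star_eq {w : ℂ} {a : Fin (m + 1) → ℂ} (hw : star w = w)
    (ha : star a = a) :
    ∃ (c : ℝ) (b : Fin (m + 1) → ℝ), ∀ x, w * (a ⬝ᵥ x) ^ d =
      (c : ℂ) * ((Complex.ofReal ∘ b) ⬝ᵥ x) ^ d := by
  refine ⟨w.re, fun j => (a j).re, fun x => ?_⟩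
  have h1 : ((w.re : ℝ) : ℂ) = w := Complex.conj_eq_iff_re.1 hw
  have h2 : (Complex.ofReal ∘ fun j => (a j).re) = a :=
    funext fun j => Complex.conj_eq_iff_re.1 (congrFun ha j)
  rw [h1, h2]

variable {v : MonomialExp m d → ℝ} {w : Fin 4 → ℂ} {a e : Fin 4 → Fin (m + 1) → ℂ}

theorem isSumOfPowers_of_real_powers (hv : ∀ α, (v α : ℂ) = powerSum d w a α) {κ : Type*}
    [Fintype κ] {c : κ → ℝ} {b : κ → Fin (m + 1) → ℝ}
    (h : ∀ x, ∑ i, w i * (a i ⬝ᵥ x) ^ d = ∑ k, (c k : ℂ) * ((Complex.ofReal ∘ b k) ⬝ᵥ x) ^ d) :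
    IsSumOfPowers d (Fintype.card κ) (formOfCoeffs v) := by
  let ε := (Fintype.equivFin κ).symm
  refine isSumOfPowers_formOfCoeffs_iff.2 ⟨c ∘ ε, b ∘ ε, funext fun α => ?_⟩
  have h1 := powerSum_eq_of_forall_eq (w := w) (a := a) (d := d) (c := Complex.ofRealHom ∘ c ∘ ε)
    (b := fun i => Complex.ofRealHom ∘ b (ε i)) fun x => by
      rw [h x]
      exact (Equiv.sum_comp ε fun k => (c k : ℂ) * ((Complex.ofReal ∘ b k) ⬝ᵥ x) ^ d).symm
  have h2 := map_powerSum (d := d) Complex.ofRealHom (c ∘ ε) (b ∘ ε) α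
  have h3 := hv α
  rw [h1] at h3
  exact Complex.ofReal_injective (h3.trans h2.symm)

theorem exists_real_powers_of_isSumOfPowers (hv : ∀ α, (v α : ℂ) = powerSum d w a α) {s : ℕ}
    (h : IsSumOfPowers d s (formOfCoeffs v)) :
    ∃ (c : Fin s → ℂ) (b : Fin s → Fin (m + 1) → ℝ), ∀ x,
      ∑ i, w i * (a i ⬝ᵥ x) ^ d = ∑ k, c k * ((Complex.ofReal ∘ b k) ⬝ᵥ x) ^ d := by
  obtain ⟨c, b, rfl⟩ := isSumOfPowers_formOfCoeffs_iff.1 h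
  refine ⟨Complex.ofReal ∘ c, b, fun x => ?_⟩
  have h1 : powerSum d w a = powerSum d (Complex.ofRealHom ∘ c) fun i => Complex.ofRealHom ∘ b i :=
    funext fun α => (hv α).symm.trans (map_powerSum Complex.ofRealHom c b α)
  rw [← eval_formOfCoeffs_powerSum, h1, eval_formOfCoeffs_powerSum]
  rfl

theorem hasSymmRank_four (hd : 2 ≤ d) (hv : ∀ α, (v α : ℂ) = powerSum d w a α)
    (hw : ∀ i, w i ≠ 0) (he : ∀ i j, a i ⬝ᵥ e j = if i = j then 1 else 0)
    (hws : ∀ i, star (w i) = w i) (has : ∀ i, star (a i) = a i) :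
    HasSymmRank d (formOfCoeffs v) 4 := by
  constructor
  · choose c b h using fun i => exists_real_power_of_star_eq (d := d) (hws i) (has i)
    simpa using isSumOfPowers_of_real_powers hv (c := c) (b := b) fun x =>
      Finset.sum_congr rfl fun i _ => h i x
  · intro s hs
    by_contra! hlt
    obtain ⟨c, b, h⟩ := exists_real_powers_of_isSumOfPowers hv hs
    obtain ⟨k, rfl⟩ := Nat.exists_eq_add_of_le' hd
    exact four_powers_ne_three (by simp; omega) hw he h

theorem hasSymmRank_add_two (hd : 2 ≤ d) (hv : ∀ α, (v α : ℂ) = powerSum d w a α)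
    (hw : ∀ i, w i ≠ 0) (he : ∀ i j, a i ⬝ᵥ e j = if i = j then 1 else 0)
    (hw0 : star (w 0) = w 0) (ha0 : star (a 0) = a 0)
    (hw1 : star (w 1) = w 1) (ha1 : star (a 1) = a 1)
    (hw3 : w 3 = star (w 2)) (ha3 : a 3 = star (a 2)) :
    HasSymmRank d (formOfCoeffs v) (d + 2) := by
  constructor
  · obtain ⟨c₀, b₀, h₀⟩ := exists_real_power_of_star_eq (d := d) hw0 ha0
    obtain ⟨c₁, b₁, h₁⟩ := exists_real_power_of_star_eq (d := d) hw1 ha1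
    obtain ⟨c, b, h⟩ := exists_real_powers_of_conj_pair (d := d) (by omega) (w 2) (a 2)
    have := isSumOfPowers_of_real_powers (κ := Fin d ⊕ Fin 2) hv (c := Sum.elim c ![c₀, c₁])
      (b := Sum.elim b ![b₀, b₁]) fun x => by
        have := h x
        simp only [Fin.sum_univ_four, hw3, ha3, Fintype.sum_sum_type, Sum.elim_inl, Sum.elim_inr,
          Fin.sum_univ_two, Matrix.cons_val_zero, Matrix.cons_val_one, ← this, ← h₀ x, ← h₁ x]
        ring
    simpa using this
  · intro s hs
    by_contra! hlt
    obtain ⟨c, b, h⟩ := exists_real_powers_of_isSumOfPowers hv hs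
    obtain ⟨k, rfl⟩ := Nat.exists_eq_add_of_le' hd
    exact one_conj_pair_ne_real_powers he ha3 k (by simp; omega) hw h

theorem hasSymmRank_two_mul (hd : 2 ≤ d) (hv : ∀ α, (v α : ℂ) = powerSum d w a α)
    (hw : ∀ i, w i ≠ 0) (he : ∀ i j, a i ⬝ᵥ e j = if i = j then 1 else 0)
    (hw1 : w 1 = star (w 0)) (ha1 : a 1 = star (a 0))
    (hw3 : w 3 = star (w 2)) (ha3 : a 3 = star (a 2)) :
    HasSymmRank d (formOfCoeffs v) (2 * d) := by
  constructor
  · obtain ⟨c, b, h⟩ := exists_real_powers_of_conj_pair (d := d) (by omega) (w 0) (a 0)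
    obtain ⟨c', b', h'⟩ := exists_real_powers_of_conj_pair (d := d) (by omega) (w 2) (a 2)
    have := isSumOfPowers_of_real_powers (κ := Fin d ⊕ Fin d) hv (c := Sum.elim c c')
      (b := Sum.elim b b') fun x => by
        simp only [Fin.sum_univ_four, hw1, ha1, hw3, ha3, Fintype.sum_sum_type, Sum.elim_inl,
          Sum.elim_inr, ← h x, ← h' x]
        ring
    simpa [two_mul] using this
  · intro s hs
    by_contra! hlt
    obtain ⟨c, b, h⟩ := exists_real_powers_of_isSumOfPowers hv hs
    obtain ⟨k, rfl⟩ := Nat.exists_eq_add_of_le' hd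
    exact two_conj_pairs_ne_real_powers he ha1 ha3 k (by simp; omega) hw h

end RealRank

/-! ### A polynomial parametrization of the secant cone and its rational inverse -/

section SecantParametrization

open Polynomial Matrix

variable {K : Type*} [Field K]

/-- The linearly recurrent sequence with initial values `u` and characteristic polynomial
`X ^ 4 - ∑ k, χ k * X ^ k`. -/
def recSeq (χ u : Fin 4 → K) : ℕ → K
  | 0 => u 0
  | 1 => u 1
  | 2 => u 2
  | 3 => u 3
  | k + 4 => χ 0 * recSeq χ u k + χ 1 * recSeq χ u (k + 1) + χ 2 * recSeq χ u (k + 2) +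
      χ 3 * recSeq χ u (k + 3)

theorem recSeq_val (χ u : Fin 4 → K) (p : Fin 4) : recSeq χ u p = u p := by
  fin_cases p <;> simp [recSeq]

theorem recSeq_eq_of_roots {χ u w t : Fin 4 → K} (ht : ∀ i, t i ^ 4 = ∑ k, χ k * t i ^ (k : ℕ))
    (hu : ∀ p, u p = ∑ i, w i * t i ^ (p : ℕ)) (k : ℕ) : recSeq χ u k = ∑ i, w i * t i ^ k := by
  have hstep : ∀ k, recSeq χ u k = ∑ i, w i * t i ^ k ∧
      recSeq χ u (k + 1) = ∑ i, w i * t i ^ (k + 1) ∧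
      recSeq χ u (k + 2) = ∑ i, w i * t i ^ (k + 2) ∧
      recSeq χ u (k + 3) = ∑ i, w i * t i ^ (k + 3) := by
    intro k
    induction k with
    | zero => exact ⟨hu 0, hu 1, hu 2, hu 3⟩
    | succ k ih =>
      obtain ⟨h0, h1, h2, h3⟩ := ih
      refine ⟨h1, h2, h3, ?_⟩
      change χ 0 * recSeq χ u k + χ 1 * recSeq χ u (k + 1) + χ 2 * recSeq χ u (k + 2) +
        χ 3 * recSeq χ u (k + 3) = _
      rw [h0, h1, h2, h3]
      simp only [Finset.mul_sum, ← Finset.sum_add_distrib]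
      refine Finset.sum_congr rfl fun i _ => ?_
      have := ht i
      simp only [Fin.sum_univ_four] at this
      have h4 : t i ^ (k + 1 + 3) = t i ^ k * t i ^ 4 := by ring
      rw [h4, this]
      simp
      ring
  exact (hstep k).1

theorem map_recSeq {L : Type*} [Field L] (f : K →+* L) (χ u : Fin 4 → K) (k : ℕ) :
    f (recSeq χ u k) = recSeq (f ∘ χ) (f ∘ u) k := by
  induction k using Nat.strong_induction_on with
  | _ k ih =>
    match k, ih with
    | 0, _ | 1, _ | 2, _ | 3, _ => rfl
    | k + 4, ih =>
      simp only [recSeq, map_add, map_mul, Function.comp, ih k (by omega), ih (k + 1) (by omega),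
        ih (k + 2) (by omega), ih (k + 3) (by omega)]

/-- The linear functional on polynomials whose moments are the terms of `recSeq χ u`. -/
noncomputable def momentFunctional (χ u : Fin 4 → K) (p : K[X]) : K :=
  p.sum fun k c => c * recSeq χ u k

theorem momentFunctional_eq_sum_range (χ u : Fin 4 → K) {p : K[X]} {N : ℕ} (hN : p.natDegree < N) :
    momentFunctional χ u p = ∑ k ∈ Finset.range N, p.coeff k * recSeq χ u k := by
  rw [momentFunctional, Polynomial.sum_over_range' p (fun k => zero_mul (recSeq χ u k)) N hN]

/-- When the quartic has the roots `t i`, the functional is a quadrature rule with nodes `t i` and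
weights `w i`. Its definition by a recurrence keeps it polynomial in `χ` and `u` and meaningful for
multiple roots. -/
theorem momentFunctional_eq_sum_eval {χ u w t : Fin 4 → K}
    (ht : ∀ i, t i ^ 4 = ∑ k, χ k * t i ^ (k : ℕ))
    (hu : ∀ p, u p = ∑ i, w i * t i ^ (p : ℕ)) (p : K[X]) :
    momentFunctional χ u p = ∑ i, w i * p.eval (t i) := by
  simp only [momentFunctional, recSeq_eq_of_roots ht hu, Polynomial.eval_eq_sum, Polynomial.sum,
    Finset.mul_sum]
  rw [Finset.sum_comm]
  refine Finset.sum_congr rfl fun i _ => Finset.sum_congr rfl fun k _ => by ring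

theorem map_momentFunctional {L : Type*} [Field L] (f : K →+* L) (χ u : Fin 4 → K) (p : K[X]) :
    f (momentFunctional χ u p) = momentFunctional (f ∘ χ) (f ∘ u) (p.map f) := by
  rw [momentFunctional_eq_sum_range χ u (Nat.lt_succ_self _),
    momentFunctional_eq_sum_range _ _ (Nat.lt_succ_of_le (natDegree_map_le (f := f) (p := p)))]
  simp [map_recSeq]

variable {n d : ℕ}

/-- The `j`-th coordinate, as a polynomial in the first one, of the points with parameter `P`. -/
noncomputable def coordPoly (P : Fin (n + 3 + 1) → Fin 4 → K) (j : Fin (n + 3 + 1)) : K[X] :=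
  if j = 0 then 1 else if j = 1 then X else ∑ k, C (P j k) * X ^ (k : ℕ)

theorem coordPoly_zero (P : Fin (n + 3 + 1) → Fin 4 → K) : coordPoly P 0 = 1 := if_pos rfl

theorem coordPoly_one (P : Fin (n + 3 + 1) → Fin 4 → K) : coordPoly P 1 = X := by
  simp [coordPoly]

theorem coordPoly_of_ne {P : Fin (n + 3 + 1) → Fin 4 → K} {j : Fin (n + 3 + 1)} (h0 : j ≠ 0)
    (h1 : j ≠ 1) : coordPoly P j = ∑ k, C (P j k) * X ^ (k : ℕ) := by
  simp [coordPoly, h0, h1]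

theorem map_coordPoly {L : Type*} [Field L] (f : K →+* L) (P : Fin (n + 3 + 1) → Fin 4 → K)
    (j : Fin (n + 3 + 1)) : (coordPoly P j).map f = coordPoly (fun j => f ∘ P j) j := by
  unfold coordPoly
  split_ifs <;> simp [Polynomial.map_sum]

theorem natDegree_coordPoly_le (P : Fin (n + 3 + 1) → Fin 4 → K) (j : Fin (n + 3 + 1)) :
    (coordPoly P j).natDegree ≤ 3 := by
  unfold coordPoly
  split_ifs
  · simp
  · simp
  · refine natDegree_sum_le_of_forall_le _ _ fun k _ => (natDegree_C_mul_X_pow_le _ _).trans ?_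
    omega

/-- A parametrization of the secant variety: the row `0` of `P` holds the initial moments, the
row `1` the polynomial that vanishes at the first coordinates of the four points, and the other
rows express the remaining coordinates by the first one. -/
noncomputable def secantParam (d : ℕ) (P : Fin (n + 3 + 1) → Fin 4 → K) :
    MonomialExp (n + 3) d → K :=
  fun α => α.1.multinomial * momentFunctional (P 1) (P 0) (∏ j, coordPoly P j ^ α.1 j)

theorem map_secantParam {L : Type*} [Field L] (f : K →+* L) (P : Fin (n + 3 + 1) → Fin 4 → K)
    (α : MonomialExp (n + 3) d) :
    f (secantParam d P α) = secantParam d (fun j => f ∘ P j) α := by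
  simp [secantParam, map_momentFunctional, Polynomial.map_prod, map_coordPoly]

theorem secantParam_eq_powerSum {P : Fin (n + 3 + 1) → Fin 4 → K} {w t : Fin 4 → K}
    (ht : ∀ i, t i ^ 4 = ∑ k, P 1 k * t i ^ (k : ℕ))
    (hu : ∀ p, P 0 p = ∑ i, w i * t i ^ (p : ℕ)) :
    secantParam d P = powerSum d w fun i j => (coordPoly P j).eval (t i) := by
  ext α
  simp [secantParam, powerSum, momentFunctional_eq_sum_eval ht hu, eval_prod]

theorem exists_weights (u : Fin 4 → K) {t : Fin 4 → K} (ht : Function.Injective t) :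
    ∃ w : Fin 4 → K, ∀ p, u p = ∑ i, w i * t i ^ (p : ℕ) := by
  have hdet : IsUnit (vandermonde t) :=
    (isUnit_iff_isUnit_det _).2 (isUnit_iff_ne_zero.2 (det_vandermonde_ne_zero_iff.2 ht))
  obtain ⟨w, hw⟩ := (vecMul_surjective_iff_isUnit.2 hdet) u
  exact ⟨w, fun p => (congrFun hw p).symm⟩

theorem exists_interpolation (y : Fin 4 → K) {t : Fin 4 → K} (ht : Function.Injective t) :
    ∃ q : Fin 4 → K, ∀ i, y i = ∑ k, q k * t i ^ (k : ℕ) := by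
  have hdet : IsUnit (vandermonde t) :=
    (isUnit_iff_isUnit_det _).2 (isUnit_iff_ne_zero.2 (det_vandermonde_ne_zero_iff.2 ht))
  obtain ⟨q, hq⟩ := (mulVec_surjective_iff_isUnit.2 hdet) y
  refine ⟨q, fun i => ?_⟩
  rw [← hq]
  simp [mulVec, dotProduct, vandermonde_apply, mul_comm]

/-- The exponent of the monomial `x_0 ^ (d - 1 - p) * x_1 ^ p * x_j`. -/
noncomputable def momentExp (n d p : ℕ) (j : Fin (n + 3 + 1)) : Fin (n + 3 + 1) →₀ ℕ :=
  Finsupp.single 0 (d - 1 - p) + Finsupp.single 1 p + Finsupp.single j 1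

/-- The coefficient of a form at `x_0 ^ (d - 1 - p) * x_1 ^ p * x_j` without the multinomial
factor. -/
noncomputable def moment (v : MonomialExp (n + 3) d → K) (p : ℕ) (j : Fin (n + 3 + 1)) : K :=
  MvPolynomial.coeff (momentExp n d p j) (formOfCoeffs v) / (momentExp n d p j).multinomial

theorem momentExp_mem {p : ℕ} (hp : p < d) (j : Fin (n + 3 + 1)) :
    momentExp n d p j ∈ Finset.finsuppAntidiag (Finset.univ : Finset (Fin (n + 3 + 1))) d := by
  have h : ∀ (i : Fin (n + 3 + 1)) (e : ℕ), ∑ x, Finsupp.single i e x = e := fun i e => by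
    rw [Finset.sum_eq_single i] <;> simp +contextual [eq_comm]
  rw [Finset.mem_finsuppAntidiag]
  refine ⟨?_, Finset.subset_univ _⟩
  change ∑ x, (Finsupp.single 0 (d - 1 - p) x + Finsupp.single 1 p x + Finsupp.single j 1 x) = d
  rw [Finset.sum_add_distrib, Finset.sum_add_distrib, h, h, h]
  omega

theorem prod_pow_momentExp {R : Type*} [CommMonoid R] (f : Fin (n + 3 + 1) → R) (p : ℕ)
    (j : Fin (n + 3 + 1)) :
    ∏ i, f i ^ momentExp n d p j i = f 0 ^ (d - 1 - p) * f 1 ^ p * f j := by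
  have h : ∀ (i : Fin (n + 3 + 1)) (e : ℕ), ∏ x, f x ^ Finsupp.single i e x = f i ^ e :=
    fun i e => by rw [Finset.prod_eq_single i] <;> simp +contextual [eq_comm]
  simp only [momentExp, Finsupp.add_apply, pow_add, Finset.prod_mul_distrib, h, pow_one]

theorem moment_eq_of_forall [CharZero K] {v : MonomialExp (n + 3) d → K}
    {F : (Fin (n + 3 + 1) → ℕ) → K} (h : ∀ α, v α = α.1.multinomial * F α.1) {p : ℕ} (hp : p < d)
    (j : Fin (n + 3 + 1)) : moment v p j = F (momentExp n d p j) := by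
  have h0 : ((momentExp n d p j).multinomial : K) ≠ 0 := by
    rw [Finsupp.multinomial_eq]
    exact_mod_cast (Nat.multinomial_pos _ _).ne'
  rw [moment, coeff_formOfCoeffs, dif_pos (momentExp_mem hp j), h, mul_div_cancel_left₀ _ h0]

theorem moment_secantParam [CharZero K] (P : Fin (n + 3 + 1) → Fin 4 → K) {p : ℕ} (hp : p < d)
    (j : Fin (n + 3 + 1)) : moment (secantParam d P) p j =
      momentFunctional (P 1) (P 0) (X ^ p * coordPoly P j) := by
  rw [moment_eq_of_forall (v := secantParam d P)
    (F := fun α => momentFunctional (P 1) (P 0) (∏ j, coordPoly P j ^ α j))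
    (fun α => rfl) hp j, prod_pow_momentExp, coordPoly_zero, coordPoly_one, one_pow, one_mul]

theorem moment_secantParam_zero [CharZero K] (P : Fin (n + 3 + 1) → Fin 4 → K) {p : ℕ}
    (hp : p < d) : moment (secantParam d P) p 0 = recSeq (P 1) (P 0) p := by
  rw [moment_secantParam P hp, coordPoly_zero, mul_one, momentFunctional,
    X_pow_eq_monomial, sum_monomial_index _ _ (by simp), one_mul]

theorem moment_secantParam_of_ne [CharZero K] (P : Fin (n + 3 + 1) → Fin 4 → K) {p : ℕ}
    (hp : p < d) {j : Fin (n + 3 + 1)} (h0 : j ≠ 0) (h1 : j ≠ 1) :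
    moment (secantParam d P) p j = ∑ q : Fin 4, recSeq (P 1) (P 0) (p + q) * P j q := by
  have hlin : X ^ p * coordPoly P j = ∑ q : Fin 4, monomial (p + q) (P j q) := by
    rw [coordPoly_of_ne h0 h1, Finset.mul_sum]
    refine Finset.sum_congr rfl fun q _ => ?_
    rw [← C_mul_X_pow_eq_monomial, pow_add]
    ring
  have hadd : ∀ (s : Finset (Fin 4)), momentFunctional (P 1) (P 0)
      (∑ q ∈ s, monomial (p + q) (P j q)) = ∑ q ∈ s, recSeq (P 1) (P 0) (p + q) * P j q := by
    intro s
    induction s using Finset.induction_on with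
    | empty => simp [momentFunctional]
    | insert a s ha ih =>
      rw [Finset.sum_insert ha, Finset.sum_insert ha, ← ih]
      simp only [momentFunctional]
      rw [sum_add_index _ _ _ (by simp) (by intros; ring), sum_monomial_index _ _ (by simp),
        mul_comm]
  rw [moment_secantParam P hp, hlin, hadd]

theorem moment_powerSum [CharZero K] {ι : Type*} [Fintype ι] (w : ι → K)
    (a : ι → Fin (n + 3 + 1) → K) {p : ℕ} (hp : p < d) (j : Fin (n + 3 + 1)) :
    moment (powerSum d w a) p j = ∑ i, w i * (a i 0 ^ (d - 1 - p) * a i 1 ^ p * a i j) := by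
  rw [moment_eq_of_forall (v := powerSum d w a) (F := fun α => ∑ i, w i * ∏ j, a i j ^ α j)
    (fun α => rfl) hp j]
  simp only [prod_pow_momentExp]

theorem map_moment {L : Type*} [Field L] (f : K →+* L) (v : MonomialExp (n + 3) d → K) (p : ℕ)
    (j : Fin (n + 3 + 1)) : f (moment v p j) = moment (f ∘ v) p j := by
  simp only [moment, map_div₀, map_natCast, coeff_formOfCoeffs]
  split_ifs <;> simp

/-- The Hankel matrix of the binary form to which a form restricts on the line through the first
two coordinate points. -/
noncomputable def hankel (v : MonomialExp (n + 3) d → K) : Matrix (Fin 4) (Fin 4) K :=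
  Matrix.of fun p q => moment v (p + q) 0

/-- The parameter of a form with non-singular Hankel matrix. -/
noncomputable def paramOf (v : MonomialExp (n + 3) d → K) (j : Fin (n + 3 + 1)) : Fin 4 → K :=
  if j = 0 then fun p => moment v p 0
  else if j = 1 then (hankel v)⁻¹ *ᵥ fun p => moment v (p + 4) 0
  else (hankel v)⁻¹ *ᵥ fun p => moment v p j

/-- The recurrence read as a linear system for its own coefficients. The moments used go up to index
`7`, which is where `8 ≤ d` is sharp. -/
theorem hankel_mulVec_charCoeffs [CharZero K] (hd : 8 ≤ d) (P : Fin (n + 3 + 1) → Fin 4 → K) :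
    hankel (secantParam d P) *ᵥ P 1 = fun p : Fin 4 => moment (secantParam d P) (p + 4) 0 := by
  ext p
  have h : ∀ q : Fin 4, hankel (secantParam d P) p q = recSeq (P 1) (P 0) (p + q) := fun q =>
    moment_secantParam_zero P (by omega)
  rw [moment_secantParam_zero P (by omega)]
  simp only [mulVec, dotProduct, h, Fin.sum_univ_four, recSeq]
  simp
  ring

theorem hankel_mulVec_of_ne [CharZero K] (hd : 8 ≤ d) (P : Fin (n + 3 + 1) → Fin 4 → K)
    {j : Fin (n + 3 + 1)} (h0 : j ≠ 0) (h1 : j ≠ 1) :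
    hankel (secantParam d P) *ᵥ P j = fun p : Fin 4 => moment (secantParam d P) p j := by
  ext p
  rw [moment_secantParam_of_ne P (by omega) h0 h1]
  simp only [mulVec, dotProduct]
  refine Finset.sum_congr rfl fun q _ => ?_
  rw [← moment_secantParam_zero P (by omega : (p : ℕ) + q < d)]
  rfl

/-- The moments of a form give row `0` directly and give all other rows as solutions of linear
systems with the Hankel matrix. -/
theorem paramOf_secantParam [CharZero K] (hd : 8 ≤ d) {P : Fin (n + 3 + 1) → Fin 4 → K}
    (hP : (hankel (secantParam d P)).det ≠ 0) : paramOf (secantParam d P) = P := by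
  have hu : IsUnit (hankel (secantParam d P)).det := isUnit_iff_ne_zero.2 hP
  funext j
  unfold paramOf
  split_ifs with h0 h1
  · subst h0
    ext p
    rw [moment_secantParam_zero P (by omega), recSeq_val]
  · subst h1
    rw [← hankel_mulVec_charCoeffs hd, mulVec_mulVec, nonsing_inv_mul _ hu, one_mulVec]
  · rw [← hankel_mulVec_of_ne hd P h0 h1, mulVec_mulVec, nonsing_inv_mul _ hu, one_mulVec]

theorem hankel_map {L : Type*} [Field L] (f : K →+* L) (v : MonomialExp (n + 3) d → K) :
    hankel (f ∘ v) = (hankel v).map f := by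
  ext p q
  simp [hankel, map_moment]

theorem det_hankel_map {L : Type*} [Field L] (f : K →+* L) (v : MonomialExp (n + 3) d → K) :
    (hankel (f ∘ v)).det = f (hankel v).det := by
  rw [hankel_map, RingHom.map_det]
  rfl

theorem paramOf_map {L : Type*} [Field L] (f : K →+* L) {v : MonomialExp (n + 3) d → K}
    (hv : (hankel v).det ≠ 0) (j : Fin (n + 3 + 1)) :
    paramOf (f ∘ v) j = f ∘ paramOf v j := by
  have hinv : (hankel (f ∘ v))⁻¹ = (hankel v)⁻¹.map f := by
    refine inv_eq_right_inv ?_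
    rw [hankel_map, ← Matrix.map_mul, mul_nonsing_inv _ (isUnit_iff_ne_zero.2 hv)]
    simp
  have hmul : ∀ y : Fin 4 → K, (hankel v)⁻¹.map f *ᵥ (f ∘ y) = f ∘ ((hankel v)⁻¹ *ᵥ y) :=
    fun y => by ext; simp [mulVec, dotProduct]
  unfold paramOf
  split_ifs
  · ext; simp [map_moment]
  · rw [hinv, ← hmul]
    congr 1; ext; simp [map_moment]
  · rw [hinv, ← hmul]
    congr 1; ext; simp [map_moment]

/-- The Vandermonde factorization of a Hankel matrix, in homogeneous form. The two projective
Vandermonde factors absorb at most six powers of `a i 0`, the diagonal keeps the remaining `d - 6`.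
A nonzero determinant therefore forces nonzero weights, nonzero `a i 0` and distinct ratios `a i 1 /
a i 0`. -/
theorem hankel_powerSum [CharZero K] (hd : 8 ≤ d) (w : Fin 4 → K)
    (a : Fin 4 → Fin (n + 3 + 1) → K) :
    hankel (powerSum d w a) = (projVandermonde (fun i => a i 1) fun i => a i 0)ᵀ *
      diagonal (fun i => w i * a i 0 ^ (d - 6)) *
      projVandermonde (fun i => a i 1) fun i => a i 0 := by
  ext p q
  rw [Matrix.mul_apply]
  simp only [Matrix.mul_diagonal, transpose_apply, projVandermonde_apply]
  rw [hankel, of_apply, moment_powerSum w a (by omega)]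
  refine Finset.sum_congr rfl fun i _ => ?_
  have h : d - 1 - (p + q : ℕ) + 1 = (Fin.rev p : ℕ) + (d - 6) + (Fin.rev q : ℕ) := by
    simp only [Fin.val_rev]
    omega
  have h' : a i 0 ^ (d - 1 - (p + q : ℕ)) * a i 0 =
      a i 0 ^ (Fin.rev p : ℕ) * a i 0 ^ (d - 6) * a i 0 ^ (Fin.rev q : ℕ) := by
    rw [← pow_succ, h, pow_add, pow_add]
  linear_combination (w i * a i 1 ^ (p + q : ℕ)) * h'

theorem ne_zero_of_det_hankel_powerSum [CharZero K] (hd : 8 ≤ d) {w : Fin 4 → K}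
    {a : Fin 4 → Fin (n + 3 + 1) → K} (h : (hankel (powerSum d w a)).det ≠ 0) (i : Fin 4) :
    w i ≠ 0 ∧ a i 0 ≠ 0 := by
  rw [hankel_powerSum hd, det_mul, det_mul, det_diagonal] at h
  have := Finset.prod_ne_zero_iff.1 (right_ne_zero_of_mul (left_ne_zero_of_mul h)) i
    (Finset.mem_univ i)
  exact ⟨left_ne_zero_of_mul this, fun h0 => this (by rw [h0, zero_pow (by omega), mul_zero])⟩

theorem injective_of_det_hankel_powerSum [CharZero K] (hd : 8 ≤ d) {w : Fin 4 → K}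
    {a : Fin 4 → Fin (n + 3 + 1) → K} (h : (hankel (powerSum d w a)).det ≠ 0) :
    Function.Injective fun i => a i 1 / a i 0 := by
  have h0 := fun i => (ne_zero_of_det_hankel_powerSum hd h i).2
  rw [hankel_powerSum hd, det_mul] at h
  have hV := right_ne_zero_of_mul h
  rw [det_projVandermonde, Finset.prod_ne_zero_iff] at hV
  have hlt : ∀ i j, i < j → a i 1 / a i 0 ≠ a j 1 / a j 0 := by
    intro i j hij heq
    refine Finset.prod_ne_zero_iff.1 (hV i (Finset.mem_univ i)) j (Finset.mem_Ioi.2 hij) ?_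
    rw [div_eq_div_iff (h0 i) (h0 j)] at heq
    rw [← heq, sub_self]
  intro i j hij
  by_contra hne
  rcases lt_or_gt_of_ne hne with h' | h'
  · exact hlt i j h' hij
  · exact hlt j i h' hij.symm

/-- Sums of four powers with non-singular Hankel matrix are in the image of the
parametrization. -/
theorem exists_secantParam_eq_powerSum [CharZero K] (hd : 8 ≤ d) {w : Fin 4 → K}
    {a : Fin 4 → Fin (n + 3 + 1) → K} (h : (hankel (powerSum d w a)).det ≠ 0) :
    ∃ P, secantParam d P = powerSum d w a := by
  have h0 := fun i => (ne_zero_of_det_hankel_powerSum hd h i).2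
  have ht := injective_of_det_hankel_powerSum hd h
  set t : Fin 4 → K := fun i => a i 1 / a i 0 with htdef
  obtain ⟨χ, hχ⟩ := exists_interpolation (fun i => t i ^ 4) ht
  choose q hq using fun j : Fin (n + 3 + 1) => exists_interpolation (fun i => a i j / a i 0) ht
  -- Each form is scaled to have first coordinate `1`, and its weight is multiplied by `a i 0 ^ d`
  -- in return.
  let P : Fin (n + 3 + 1) → Fin 4 → K := fun j =>
    if j = 0 then fun p => ∑ i, w i * a i 0 ^ d * t i ^ (p : ℕ) else if j = 1 then χ else q j
  have hP0 : P 0 = fun p : Fin 4 => ∑ i, w i * a i 0 ^ d * t i ^ (p : ℕ) := if_pos rfl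
  have hP1 : P 1 = χ := by simp [P]
  have hcoord : ∀ i j, (coordPoly P j).eval (t i) = a i j / a i 0 := by
    intro i j
    by_cases hj0 : j = 0
    · subst hj0; simp [coordPoly_zero, h0 i]
    by_cases hj1 : j = 1
    · subst hj1; simp [coordPoly_one, t]
    · have hPj : P j = q j := by simp [P, hj0, hj1]
      rw [coordPoly_of_ne hj0 hj1, hPj, hq j i, eval_finsetSum]
      simp
  refine ⟨P, ?_⟩
  rw [secantParam_eq_powerSum (w := fun i => w i * a i 0 ^ d) (t := t) (by rw [hP1]; exact hχ)
    (fun p => congrFun hP0 p)]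
  ext α
  simp only [powerSum, hcoord, div_pow, Finset.prod_div_distrib, Finset.prod_pow_eq_pow_sum,
    α.sum_eq]
  congr 1
  refine Finset.sum_congr rfl fun i _ => ?_
  rw [mul_assoc, mul_div_cancel₀ _ (pow_ne_zero _ (h0 i))]

/-- The forms that the parametrization recovers include all sums of four powers with non-singular
Hankel matrix. -/
theorem secantParam_paramOf_of_isSumOfPowers [CharZero K] (hd : 8 ≤ d)
    {v : MonomialExp (n + 3) d → K} (hv : IsSumOfPowers d 4 (formOfCoeffs v))
    (h : (hankel v).det ≠ 0) : secantParam d (paramOf v) = v := by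
  obtain ⟨w, a, rfl⟩ := isSumOfPowers_formOfCoeffs_iff.1 hv
  obtain ⟨P, hP⟩ := exists_secantParam_eq_powerSum hd h
  rw [← hP] at h ⊢
  rw [paramOf_secantParam hd h]

end SecantParametrization

/-! ### Smoothness of the parametrization and passage to the closure -/

section Continuity

open Polynomial Matrix Topology Filter

variable {𝕜 : Type*} [NontriviallyNormedField 𝕜] {n d : ℕ}

theorem contDiff_recSeq (k : ℕ) :
    ContDiff 𝕜 ∞ fun P : Fin (n + 3 + 1) → Fin 4 → 𝕜 => recSeq (P 1) (P 0) k := by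
  induction k using Nat.strong_induction_on with
  | _ k ih =>
    match k, ih with
    | 0, _ | 1, _ | 2, _ | 3, _ => exact contDiff_apply_apply 𝕜 𝕜 _ _
    | k + 4, ih =>
      have h := fun i : Fin 4 => contDiff_apply_apply 𝕜 𝕜 (n := ∞) (1 : Fin (n + 3 + 1)) i
      exact ((((h 0).mul (ih k (by omega))).add ((h 1).mul (ih (k + 1) (by omega)))).add
        ((h 2).mul (ih (k + 2) (by omega)))).add ((h 3).mul (ih (k + 3) (by omega)))

theorem contDiff_coeff_coordPoly (j : Fin (n + 3 + 1)) (k : ℕ) :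
    ContDiff 𝕜 ∞ fun P : Fin (n + 3 + 1) → Fin 4 → 𝕜 => (coordPoly P j).coeff k := by
  unfold coordPoly
  split_ifs
  · exact contDiff_const
  · exact contDiff_const
  · simp only [finsetSum_coeff, coeff_C_mul]
    exact ContDiff.sum fun i _ => (contDiff_apply_apply 𝕜 𝕜 _ _).mul contDiff_const

theorem contDiff_coeff_mul {E : Type*} [NormedAddCommGroup E] [NormedSpace 𝕜 E] {f g : E → 𝕜[X]}
    (hf : ∀ k, ContDiff 𝕜 ∞ fun x => (f x).coeff k)
    (hg : ∀ k, ContDiff 𝕜 ∞ fun x => (g x).coeff k) (k : ℕ) :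
    ContDiff 𝕜 ∞ fun x => (f x * g x).coeff k := by
  simp only [coeff_mul]
  exact ContDiff.sum fun i _ => (hf _).mul (hg _)

theorem contDiff_coeff_pow {E : Type*} [NormedAddCommGroup E] [NormedSpace 𝕜 E] {f : E → 𝕜[X]}
    (hf : ∀ k, ContDiff 𝕜 ∞ fun x => (f x).coeff k) (e k : ℕ) :
    ContDiff 𝕜 ∞ fun x => (f x ^ e).coeff k := by
  induction e generalizing k with
  | zero => simpa using contDiff_const
  | succ e ih => simpa only [pow_succ] using contDiff_coeff_mul ih hf k

theorem contDiff_coeff_prod {E ι : Type*} [NormedAddCommGroup E] [NormedSpace 𝕜 E]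
    {f : ι → E → 𝕜[X]} (hf : ∀ i k, ContDiff 𝕜 ∞ fun x => (f i x).coeff k) (s : Finset ι) (k : ℕ) :
    ContDiff 𝕜 ∞ fun x => (∏ i ∈ s, f i x).coeff k := by
  classical
  induction s using Finset.induction_on generalizing k with
  | empty => simpa using contDiff_const
  | insert i s hi ih => simpa only [Finset.prod_insert hi] using contDiff_coeff_mul (hf i) ih k

theorem natDegree_prod_coordPoly_lt {K : Type*} [Field K] (P : Fin (n + 3 + 1) → Fin 4 → K)
    (α : MonomialExp (n + 3) d) : (∏ j, coordPoly P j ^ α.1 j).natDegree < 3 * d + 1 := by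
  refine Nat.lt_succ_of_le ((natDegree_prod_le _ _).trans ?_)
  calc ∑ j, (coordPoly P j ^ α.1 j).natDegree ≤ ∑ j, α.1 j * 3 :=
        Finset.sum_le_sum fun j _ => natDegree_pow_le.trans
          (Nat.mul_le_mul_left _ (natDegree_coordPoly_le P j))
    _ = 3 * d := by rw [← Finset.sum_mul, α.sum_eq, mul_comm]

theorem contDiff_secantParam :
    ContDiff 𝕜 ∞ (secantParam d : (Fin (n + 3 + 1) → Fin 4 → 𝕜) → _) := by
  refine contDiff_pi.2 fun α => ?_
  simp only [secantParam, momentFunctional_eq_sum_range _ _ (natDegree_prod_coordPoly_lt _ α)]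
  refine contDiff_const.mul (ContDiff.sum fun k _ => ContDiff.mul ?_ (contDiff_recSeq k))
  exact contDiff_coeff_prod (fun j => contDiff_coeff_pow (contDiff_coeff_coordPoly j) _) _ _

theorem continuous_moment (p : ℕ) (j : Fin (n + 3 + 1)) :
    Continuous fun v : MonomialExp (n + 3) d → 𝕜 => moment v p j := by
  simp only [moment, coeff_formOfCoeffs]
  split_ifs
  · exact (continuous_apply _).div_const _
  · exact continuous_const

theorem continuous_hankel :
    Continuous (hankel : (MonomialExp (n + 3) d → 𝕜) → Matrix (Fin 4) (Fin 4) 𝕜) :=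
  continuous_matrix fun _ _ => continuous_moment _ _

theorem continuous_det_hankel :
    Continuous fun v : MonomialExp (n + 3) d → 𝕜 => (hankel v).det :=
  continuous_hankel.matrix_det

theorem continuousAt_paramOf {v : MonomialExp (n + 3) d → 𝕜} (hv : (hankel v).det ≠ 0) :
    ContinuousAt paramOf v := by
  have hinv : ∀ p q, ContinuousAt (fun v : MonomialExp (n + 3) d → 𝕜 => (hankel v)⁻¹ p q) v := by
    intro p q
    simp only [Matrix.inv_def, Ring.inverse_eq_inv', Matrix.smul_apply, smul_eq_mul]
    exact (continuous_det_hankel.continuousAt.inv₀ hv).mul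
      (continuous_hankel.matrix_adjugate.matrix_elem p q).continuousAt
  have hmul : ∀ (p : Fin 4) (f : Fin 4 → (MonomialExp (n + 3) d → 𝕜) → 𝕜),
      (∀ q, Continuous (f q)) →
      ContinuousAt (fun v => ((hankel v)⁻¹ *ᵥ fun q => f q v) p) v := by
    intro p f hf
    simp only [mulVec, dotProduct]
    exact tendsto_finsetSum _ fun q _ => (hinv p q).mul (hf q).continuousAt
  refine continuousAt_pi.2 fun j => continuousAt_pi.2 fun p => ?_
  unfold paramOf
  split_ifs
  · exact (continuous_moment _ _).continuousAt
  · exact hmul p (fun q v => moment v (q + 4) 0) fun q => continuous_moment _ _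
  · exact hmul p (fun q v => moment v q j) fun q => continuous_moment _ _

/-- The monic polynomial of degree four with lower coefficients `-χ`. -/
noncomputable def quartic {K : Type*} [Field K] (χ : Fin 4 → K) : K[X] :=
  X ^ 4 - ∑ k, C (χ k) * X ^ (k : ℕ)

section Quartic

variable {K : Type*} [Field K] (χ : Fin 4 → K)

theorem isMonicOfDegree_quartic : IsMonicOfDegree (quartic χ) 4 := by
  refine (isMonicOfDegree_X_pow (R := K) 4).sub ?_
  refine Nat.lt_succ_of_le (natDegree_sum_le_of_forall_le _ _ fun k _ =>
    (natDegree_C_mul_X_pow_le _ _).trans ?_)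
  omega

theorem isRoot_quartic_iff {t : K} : (quartic χ).IsRoot t ↔ t ^ 4 = ∑ k, χ k * t ^ (k : ℕ) := by
  simp [quartic, IsRoot.def, eval_finsetSum, sub_eq_zero]

theorem map_quartic {L : Type*} [Field L] (f : K →+* L) :
    (quartic χ).map f = quartic (f ∘ χ) := by
  simp [quartic, Polynomial.map_sum]

theorem quartic_add_single (ε : K) : quartic (χ + Pi.single 0 ε) = quartic χ - C ε := by
  simp [quartic, Fin.sum_univ_four]
  ring

/-- Changing the constant term by `ε` creates a multiple root only if `ε` is the value of the
quartic at a zero of its derivative, which leaves finitely many `ε`. -/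
theorem finite_setOf_not_nodup_roots [CharZero K] :
    {ε | ¬ (quartic (χ + Pi.single 0 ε)).roots.Nodup}.Finite := by
  classical
  have hder : derivative (quartic χ) ≠ 0 := by
    intro h
    have := congrArg natDegree h
    rw [natDegree_derivative, (isMonicOfDegree_quartic χ).natDegree_eq] at this
    simp at this
  refine ((derivative (quartic χ)).roots.toFinset.image
    fun z => (quartic χ).eval z).finite_toSet.subset fun ε hε => ?_
  simp only [Set.mem_ofPred_eq, Multiset.nodup_iff_count_le_one, not_forall, not_le,
    count_roots] at hε
  obtain ⟨z, hz⟩ := hε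
  have h := (one_lt_rootMultiplicity_iff_isRoot (isMonicOfDegree_quartic _).ne_zero).1 hz
  rw [quartic_add_single] at h
  simp only [IsRoot.def, eval_sub, eval_C, derivative_sub, derivative_C, sub_zero] at h
  simp only [Finset.coe_image, Set.mem_image, Finset.mem_coe, Multiset.mem_toFinset,
    mem_roots hder]
  exact ⟨z, h.2, sub_eq_zero.1 h.1⟩

theorem exists_injective_roots [IsAlgClosed K] (h : (quartic χ).roots.Nodup) :
    ∃ t : Fin 4 → K, Function.Injective t ∧ ∀ i, t i ^ 4 = ∑ k, χ k * t i ^ (k : ℕ) := by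
  classical
  have hcard : (quartic χ).roots.toFinset.card = 4 := by
    rw [Multiset.toFinset_card_of_nodup h, ← (isMonicOfDegree_quartic χ).natDegree_eq]
    exact (splits_iff_card_roots).1 (IsAlgClosed.splits _)
  let ε := ((quartic χ).roots.toFinset.equivFinOfCardEq hcard).symm
  refine ⟨fun i => ε i, Subtype.val_injective.comp ε.injective, fun i => ?_⟩
  rw [← isRoot_quartic_iff]
  exact (mem_roots (isMonicOfDegree_quartic χ).ne_zero).1 (Multiset.mem_toFinset.1 (ε i).2)

end Quartic

theorem eventually_notMem_of_finite {s : Set 𝕜} (hs : s.Finite) : ∀ᶠ ε in 𝓝[≠] (0 : 𝕜), ε ∉ s := by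
  have h : (s \ {0})ᶜ ∈ 𝓝 (0 : 𝕜) := (hs.subset Set.sdiff_subset).isClosed.isOpen_compl.mem_nhds
    (by simp)
  filter_upwards [nhdsWithin_le_nhds h, self_mem_nhdsWithin] with ε h1 h2 h3
  exact h1 ⟨h3, h2⟩

/-- A parameter whose quartic has multiple roots is a limit of parameters with simple roots, whose
images are sums of four powers. -/
theorem secantParam_mem_secantCone (P : Fin (n + 3 + 1) → Fin 4 → ℂ) :
    secantParam d P ∈ secantCone (n + 3) d 4 := by
  let Q : ℂ → Fin (n + 3 + 1) → Fin 4 → ℂ := fun ε => Function.update P 1 (P 1 + Pi.single 0 ε)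
  have hQ0 : Q 0 = P := by simp [Q]
  have hQ : Continuous Q := by
    refine continuous_const.update 1 (continuous_const.add ?_)
    exact continuous_single (A := fun _ => ℂ) (0 : Fin 4)
  have hlim : Tendsto (fun ε => secantParam d (Q ε)) (𝓝[≠] 0) (𝓝 (secantParam d P)) := by
    have := ((contDiff_secantParam (𝕜 := ℂ) (d := d)).continuous.comp hQ).tendsto 0
    simp only [Function.comp, hQ0] at this
    exact this.mono_left nhdsWithin_le_nhds
  refine mem_closure_of_tendsto hlim ?_
  filter_upwards [eventually_notMem_of_finite (finite_setOf_not_nodup_roots (P 1))] with ε hε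
  have hQ1 : Q ε 1 = P 1 + Pi.single 0 ε := Function.update_self ..
  rw [not_not, ← hQ1] at hε
  obtain ⟨t, ht, hroot⟩ := exists_injective_roots _ hε
  obtain ⟨w, hw⟩ := exists_weights (Q ε 0) ht
  rw [secantParam_eq_powerSum hroot hw]
  exact isSumOfPowers_formOfCoeffs_iff.2 ⟨_, _, rfl⟩

/-- The identity holds on sums of four powers with nonzero Hankel determinant. Both sides are
continuous where that determinant is nonzero, so it extends to the closure there. -/
theorem secantParam_paramOf_of_mem_secantCone (hd : 8 ≤ d) {v : MonomialExp (n + 3) d → ℂ}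
    (hv : v ∈ secantCone (n + 3) d 4) (h : (hankel v).det ≠ 0) :
    secantParam d (paramOf v) = v := by
  have hne : (𝓝[{v | IsSumOfPowers d 4 (formOfCoeffs v)}] v).NeBot :=
    mem_closure_iff_nhdsWithin_neBot.1 hv
  have h1 : Tendsto (fun v => secantParam d (paramOf v))
      (𝓝[{v | IsSumOfPowers d 4 (formOfCoeffs v)}] v) (𝓝 (secantParam d (paramOf v))) :=
    ((contDiff_secantParam (𝕜 := ℂ) (d := d)).continuous.continuousAt.comp
      (continuousAt_paramOf h)).mono_left nhdsWithin_le_nhds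
  have h2 : Tendsto (fun v => v) (𝓝[{v | IsSumOfPowers d 4 (formOfCoeffs v)}] v) (𝓝 v) :=
    nhdsWithin_le_nhds
  refine tendsto_nhds_unique (h1.congr' ?_) h2
  filter_upwards [self_mem_nhdsWithin,
    nhdsWithin_le_nhds ((continuous_det_hankel (𝕜 := ℂ)).continuousAt.eventually_ne h)]
    with v' hv' hdet
  exact secantParam_paramOf_of_isSumOfPowers hd hv' hdet

theorem secantParam_mem_realSecantCone (P : Fin (n + 3 + 1) → Fin 4 → ℝ) :
    secantParam d P ∈ realSecantCone (n + 3) d 4 := by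
  have h : Complex.ofRealHom ∘ secantParam d P = secantParam d fun j => Complex.ofRealHom ∘ P j :=
    funext (map_secantParam Complex.ofRealHom P)
  change Complex.ofRealHom ∘ secantParam d P ∈ secantCone (n + 3) d 4
  rw [h]
  exact secantParam_mem_secantCone _

/-- The inverse is a rational map with rational coefficients, so it commutes with the inclusion of
the reals and real forms have real parameters. -/
theorem secantParam_paramOf_of_mem_realSecantCone (hd : 8 ≤ d) {v : MonomialExp (n + 3) d → ℝ}
    (hv : v ∈ realSecantCone (n + 3) d 4) (h : (hankel v).det ≠ 0) :
    secantParam d (paramOf v) = v := by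
  have hdet : (hankel (Complex.ofRealHom ∘ v)).det ≠ 0 := by
    rw [det_hankel_map]
    simpa using h
  have key : secantParam d (paramOf (Complex.ofRealHom ∘ v)) = Complex.ofRealHom ∘ v :=
    secantParam_paramOf_of_mem_secantCone hd hv hdet
  ext α
  have h1 := congrFun key α
  rw [funext fun j => paramOf_map Complex.ofRealHom h j, ← map_secantParam] at h1
  exact Complex.ofReal_injective h1

end Continuity

/-! ### From the root type of the quartic to the real rank -/

section RankOfParameter

open Polynomial Matrix

variable {n d : ℕ}

/-- The quartic `X ^ 4 - ∑ k, χ k * X ^ k` has four distinct complex roots, on which complex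
conjugation acts by the permutation `σ`. -/
def HasConjRoots (σ : Equiv.Perm (Fin 4)) (χ : Fin 4 → ℝ) : Prop :=
  ∃ t : Fin 4 → ℂ, Function.Injective t ∧ (∀ i, t i ^ 4 = ∑ k, (χ k : ℂ) * t i ^ (k : ℕ)) ∧
    ∀ i, star (t i) = t (σ i)

/-- The first four coordinates of the four points form the product of a Vandermonde matrix and the
coefficient matrix `Q`, whose determinant is the 2 by 2 minor in `hP`. The points are thus
independent, and the columns of the inverse give the dual vectors. -/
theorem exists_dual_coordPoly {K : Type*} [Field K] {P : Fin (n + 3 + 1) → Fin 4 → K}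
    (hP : P 2 2 * P 3 3 - P 2 3 * P 3 2 ≠ 0) {t : Fin 4 → K} (ht : Function.Injective t) :
    ∃ e : Fin 4 → Fin (n + 3 + 1) → K, ∀ i k,
      (fun j => (coordPoly P j).eval (t i)) ⬝ᵥ e k = if i = k then 1 else 0 := by
  let ι : Fin 4 → Fin (n + 3 + 1) := ![0, 1, 2, 3]
  let Q : Matrix (Fin 4) (Fin 4) K := !![1, 0, P 2 0, P 3 0; 0, 1, P 2 1, P 3 1;
    0, 0, P 2 2, P 3 2; 0, 0, P 2 3, P 3 3]
  have hQ : Q.det ≠ 0 := by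
    convert hP using 1
    simp [Q, det_succ_row_zero, Fin.sum_univ_succ, Fin.succAbove]
    ring
  have hdet : IsUnit (vandermonde t * Q).det := by
    rw [det_mul]
    exact isUnit_iff_ne_zero.2 (mul_ne_zero (det_vandermonde_ne_zero_iff.2 ht) hQ)
  have h20 : (2 : Fin (n + 3 + 1)) ≠ 0 := by
    simp [Fin.ext_iff, Nat.mod_eq_of_lt (show 2 < n + 3 + 1 by omega)]
  have h21 : (2 : Fin (n + 3 + 1)) ≠ 1 := by
    simp [Fin.ext_iff, Nat.mod_eq_of_lt (show 2 < n + 3 + 1 by omega)]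
  have h30 : (3 : Fin (n + 3 + 1)) ≠ 0 := by
    simp [Fin.ext_iff, Nat.mod_eq_of_lt (show 3 < n + 3 + 1 by omega)]
  have h31 : (3 : Fin (n + 3 + 1)) ≠ 1 := by
    simp [Fin.ext_iff, Nat.mod_eq_of_lt (show 3 < n + 3 + 1 by omega)]
  have hcoord : ∀ i j, (coordPoly P (ι j)).eval (t i) = (vandermonde t * Q) i j := by
    intro i j
    rw [mul_apply, Fin.sum_univ_four]
    fin_cases j
    · simp [ι, Q, coordPoly_zero, vandermonde_apply]
    · simp [ι, Q, coordPoly_one, vandermonde_apply]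
    · simp [ι, Q, coordPoly_of_ne h20 h21, vandermonde_apply, Fin.sum_univ_four]
      ring
    · simp [ι, Q, coordPoly_of_ne h30 h31, vandermonde_apply, Fin.sum_univ_four]
      ring
  refine ⟨fun k => ∑ j, (vandermonde t * Q)⁻¹ j k • Pi.single (ι j) 1, fun i k => ?_⟩
  have := congrFun (congrFun (mul_nonsing_inv _ hdet) i) k
  rw [mul_apply, one_apply] at this
  rw [← this, dotProduct_sum]
  refine Finset.sum_congr rfl fun j _ => ?_
  rw [dotProduct_smul, dotProduct_single_one, hcoord, smul_eq_mul, mul_comm]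

theorem exists_decomposition_secantParam (hd : 8 ≤ d) {P : Fin (n + 3 + 1) → Fin 4 → ℝ}
    (hdet : (hankel (secantParam d P)).det ≠ 0) (hP : P 2 2 * P 3 3 - P 2 3 * P 3 2 ≠ 0)
    {σ : Equiv.Perm (Fin 4)} (hσ : HasConjRoots σ (P 1)) :
    ∃ (w : Fin 4 → ℂ) (a e : Fin 4 → Fin (n + 3 + 1) → ℂ),
      (∀ α, ((secantParam d P α : ℝ) : ℂ) = powerSum d w a α) ∧ (∀ i, w i ≠ 0) ∧
      (∀ i j, a i ⬝ᵥ e j = if i = j then 1 else 0) ∧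
      (∀ i, star (w i) = w (σ i)) ∧ ∀ i, star (a i) = a (σ i) := by
  obtain ⟨t, ht, hroot, hconj⟩ := hσ
  set PC : Fin (n + 3 + 1) → Fin 4 → ℂ := fun j => Complex.ofRealHom ∘ P j with hPC
  obtain ⟨w, hw⟩ := exists_weights (PC 0) ht
  have hsum := secantParam_eq_powerSum (d := d) (P := PC) hroot hw
  have hmap : Complex.ofRealHom ∘ secantParam d P = secantParam d PC :=
    funext (map_secantParam Complex.ofRealHom P)
  have hdetC : (hankel (powerSum d w fun i j => (coordPoly PC j).eval (t i))).det ≠ 0 := by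
    rw [← hsum, ← hmap, det_hankel_map]
    simpa using hdet
  have hPC' : PC 2 2 * PC 3 3 - PC 2 3 * PC 3 2 ≠ 0 := by
    have h : PC 2 2 * PC 3 3 - PC 2 3 * PC 3 2 =
        ((P 2 2 * P 3 3 - P 2 3 * P 3 2 : ℝ) : ℂ) := by simp [hPC]
    rw [h]
    exact_mod_cast hP
  obtain ⟨e, he⟩ := exists_dual_coordPoly hPC' ht
  refine ⟨w, fun i j => (coordPoly PC j).eval (t i), e, fun α => ?_, fun i =>
    (ne_zero_of_det_hankel_powerSum hd hdetC i).1, he, ?_, fun i => ?_⟩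
  · rw [← hsum, ← hmap]
    rfl
  -- The moments are real, so the conjugated and permuted weights solve the same Vandermonde system,
  -- whose solution is unique.
  · have hzero : (fun i => star (w (σ.symm i)) - w i) = 0 := by
      refine eq_zero_of_forall_pow_sum_mul_pow_eq_zero ht fun p => ?_
      simp only [sub_mul, Finset.sum_sub_distrib, ← hw p]
      rw [sub_eq_zero, ← Equiv.sum_comp σ]
      simp only [Equiv.symm_apply_apply, ← hconj]
      have := congrArg star (hw p)
      simpa [hPC] using this.symm
    intro i
    have := congrFun hzero (σ i)
    simpa [sub_eq_zero] using this
  · ext j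
    have h : coordPoly PC j = (coordPoly P j).map Complex.ofRealHom := (map_coordPoly _ P j).symm
    simp only [Pi.star_apply, ← hconj, h, eval_map]
    exact hom_eval₂ (coordPoly P j) Complex.ofRealHom (starRingEnd ℂ) (t i) |>.trans (by
      congr 1
      ext x
      simp)

theorem hasSymmRank_secantParam (hd : 8 ≤ d) {P : Fin (n + 3 + 1) → Fin 4 → ℝ}
    (hdet : (hankel (secantParam d P)).det ≠ 0) (hP : P 2 2 * P 3 3 - P 2 3 * P 3 2 ≠ 0) :
    (HasConjRoots 1 (P 1) → HasSymmRank d (formOfCoeffs (secantParam d P)) 4) ∧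
    (HasConjRoots (Equiv.swap 2 3) (P 1) →
      HasSymmRank d (formOfCoeffs (secantParam d P)) (d + 2)) ∧
    (HasConjRoots (Equiv.swap 0 1 * Equiv.swap 2 3) (P 1) →
      HasSymmRank d (formOfCoeffs (secantParam d P)) (2 * d)) := by
  refine ⟨fun h => ?_, fun h => ?_, fun h => ?_⟩ <;>
    obtain ⟨w, a, e, hv, hw, he, hws, has⟩ := exists_decomposition_secantParam hd hdet hP h
  · exact hasSymmRank_four (by omega) hv hw he hws has
  · exact hasSymmRank_add_two (by omega) hv hw he (hws 0) (has 0) (hws 1) (has 1)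
      (hws 2).symm (has 2).symm
  · exact hasSymmRank_two_mul (by omega) hv hw he (hws 0).symm (has 0).symm
      (hws 2).symm (has 2).symm

end RankOfParameter

/-! ### Real quartics as products of two real quadratics -/

section Quadratics

open Polynomial

/-- The coefficients `χ` with
`(X ^ 2 + x 0 * X + x 1) * (X ^ 2 + x 2 * X + x 3) = X ^ 4 - ∑ k, χ k * X ^ k`. -/
def quadMul (x : Fin 4 → ℝ) : Fin 4 → ℝ :=
  ![-(x 1 * x 3), -(x 0 * x 3 + x 1 * x 2), -(x 1 + x 0 * x 2 + x 3), -(x 0 + x 2)]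

/-- The resultant of `X ^ 2 + x 0 * X + x 1` and `X ^ 2 + x 2 * X + x 3`. -/
def quadRes (x : Fin 4 → ℝ) : ℝ := (x 1 - x 3) ^ 2 + (x 0 - x 2) * (x 0 * x 3 - x 1 * x 2)

theorem quartic_quadMul (x : Fin 4 → ℝ) : quartic (quadMul x) =
    (X ^ 2 + C (x 0) * X + C (x 1)) * (X ^ 2 + C (x 2) * X + C (x 3)) := by
  simp [quartic, quadMul, Fin.sum_univ_four]
  ring

theorem hasConjRoots_quadMul {x : Fin 4 → ℝ} (hres : quadRes x ≠ 0) {t : Fin 4 → ℂ}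
    {σ : Equiv.Perm (Fin 4)} (h01 : t 0 ≠ t 1) (h23 : t 2 ≠ t 3) (hs : t 0 + t 1 = -x 0)
    (hp : t 0 * t 1 = x 1) (hs' : t 2 + t 3 = -x 2) (hp' : t 2 * t 3 = x 3)
    (hσ : ∀ i, star (t i) = t (σ i)) : HasConjRoots σ (quadMul x) := by
  have hx0 : (x 0 : ℂ) = -(t 0 + t 1) := by rw [hs, neg_neg]
  have hx2 : (x 2 : ℂ) = -(t 2 + t 3) := by rw [hs', neg_neg]
  have hprod : (t 0 - t 2) * (t 0 - t 3) * (t 1 - t 2) * (t 1 - t 3) = (quadRes x : ℂ) := by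
    simp only [quadRes]
    push_cast
    rw [hx0, hx2, ← hp, ← hp']
    ring
  have hne : (t 0 - t 2) * (t 0 - t 3) * (t 1 - t 2) * (t 1 - t 3) ≠ 0 := by
    rw [hprod]
    exact_mod_cast hres
  simp only [mul_ne_zero_iff, sub_ne_zero] at hne
  obtain ⟨⟨⟨h02, h03⟩, h12⟩, h13⟩ := hne
  refine ⟨t, ?_, ?_, hσ⟩
  · intro i j hij
    fin_cases i <;> fin_cases j <;> simp_all
  · intro i
    simp only [quadMul, Fin.sum_univ_four]
    simp
    rw [hx0, hx2, ← hp, ← hp']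
    fin_cases i <;> simp <;> ring

theorem exists_real_roots_of_discrim_pos {a b : ℝ} (h : 0 < a ^ 2 - 4 * b) :
    ∃ r s : ℝ, r ≠ s ∧ r + s = -a ∧ r * s = b := by
  have hsq := Real.sq_sqrt h.le
  have hpos := Real.sqrt_pos.2 h
  refine ⟨(-a + √(a ^ 2 - 4 * b)) / 2, (-a - √(a ^ 2 - 4 * b)) / 2, ?_, by ring, by nlinarith⟩
  intro heq
  linarith

theorem exists_conj_roots_of_discrim_neg {a b : ℝ} (h : a ^ 2 - 4 * b < 0) :
    ∃ z : ℂ, z ≠ star z ∧ z + star z = -a ∧ z * star z = b := by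
  have hsq := Real.sq_sqrt (by linarith : 0 ≤ 4 * b - a ^ 2)
  have hpos := Real.sqrt_pos.2 (by linarith : 0 < 4 * b - a ^ 2)
  refine ⟨⟨-a / 2, √(4 * b - a ^ 2) / 2⟩, ?_, ?_, ?_⟩
  · intro heq
    have := congrArg Complex.im heq
    simp at this
    linarith
  · apply Complex.ext <;> simp
  · apply Complex.ext <;> simp
    · nlinarith
    · ring

theorem hasConjRoots_quadMul_one {x : Fin 4 → ℝ} (h : 0 < x 0 ^ 2 - 4 * x 1)
    (h' : 0 < x 2 ^ 2 - 4 * x 3) (hres : quadRes x ≠ 0) : HasConjRoots 1 (quadMul x) := by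
  obtain ⟨r, s, hne, hs, hp⟩ := exists_real_roots_of_discrim_pos h
  obtain ⟨r', s', hne', hs', hp'⟩ := exists_real_roots_of_discrim_pos h'
  refine hasConjRoots_quadMul (t := ![r, s, r', s']) hres (by simpa using hne) (by simpa using hne')
    (by simpa using congrArg Complex.ofReal hs) (by simpa using congrArg Complex.ofReal hp)
    (by simpa using congrArg Complex.ofReal hs') (by simpa using congrArg Complex.ofReal hp')
    fun i => ?_
  fin_cases i <;> simp

theorem hasConjRoots_quadMul_swap {x : Fin 4 → ℝ} (h : 0 < x 0 ^ 2 - 4 * x 1)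
    (h' : x 2 ^ 2 - 4 * x 3 < 0) (hres : quadRes x ≠ 0) :
    HasConjRoots (Equiv.swap 2 3) (quadMul x) := by
  obtain ⟨r, s, hne, hs, hp⟩ := exists_real_roots_of_discrim_pos h
  obtain ⟨z, hne', hs', hp'⟩ := exists_conj_roots_of_discrim_neg h'
  refine hasConjRoots_quadMul (t := ![r, s, z, star z]) hres (by simpa using hne)
    (by simpa using hne')
    (by simpa using congrArg Complex.ofReal hs) (by simpa using congrArg Complex.ofReal hp)
    (by simpa using hs') (by simpa using hp')
    fun i => ?_
  fin_cases i <;> simp [Equiv.swap_apply_def]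

theorem hasConjRoots_quadMul_swap_swap {x : Fin 4 → ℝ} (h : x 0 ^ 2 - 4 * x 1 < 0)
    (h' : x 2 ^ 2 - 4 * x 3 < 0) (hres : quadRes x ≠ 0) :
    HasConjRoots (Equiv.swap 0 1 * Equiv.swap 2 3) (quadMul x) := by
  obtain ⟨z, hne, hs, hp⟩ := exists_conj_roots_of_discrim_neg h
  obtain ⟨z', hne', hs', hp'⟩ := exists_conj_roots_of_discrim_neg h'
  refine hasConjRoots_quadMul (t := ![z, star z, z', star z']) hres (by simpa using hne)
    (by simpa using hne') (by simpa using hs) (by simpa using hp)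
    (by simpa using hs') (by simpa using hp')
    fun i => ?_
  fin_cases i <;> simp [Equiv.swap_apply_def]

theorem quartic_injective {K : Type*} [Field K] :
    Function.Injective (quartic : (Fin 4 → K) → K[X]) := by
  intro χ χ' h
  ext k
  have := congrArg (coeff · k) h
  fin_cases k <;> simpa [quartic, Fin.sum_univ_four, coeff_X, coeff_X_pow, coeff_one] using this

/-- Every real monic quartic splits into two real monic quadratics, so its root type is read from
two discriminants. -/
theorem exists_quadMul_eq (χ : Fin 4 → ℝ) : ∃ x, χ = quadMul x := by
  have hquad : ∀ f : ℝ[X], IsMonicOfDegree f 2 →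
      f = X ^ 2 + C (f.coeff 1) * X + C (f.coeff 0) := by
    intro f hf
    have h2 : f.coeff 2 = 1 := by
      have := hf.leadingCoeff_eq
      rwa [leadingCoeff, hf.natDegree_eq] at this
    conv_lhs => rw [f.as_sum_range_C_mul_X_pow, hf.natDegree_eq]
    simp [Finset.sum_range_succ, h2]
    ring
  obtain ⟨f, g, hf, hg, hfg⟩ :=
    IsMonicOfDegree.eq_isMonicOfDegree_two_mul_isMonicOfDegree (n := 2) (isMonicOfDegree_quartic χ)
  refine ⟨![f.coeff 1, f.coeff 0, g.coeff 1, g.coeff 0], quartic_injective ?_⟩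
  rw [quartic_quadMul, hfg]
  conv_lhs => rw [hquad f hf, hquad g hg]
  simp

theorem exists_complex_roots (a b : ℝ) : ∃ z z' : ℂ, (a : ℂ) = -(z + z') ∧ (b : ℂ) = z * z' := by
  obtain ⟨s, hs⟩ := IsAlgClosed.exists_pow_nat_eq ((a : ℂ) ^ 2 - 4 * b) two_pos
  exact ⟨(-a + s) / 2, (-a - s) / 2, by ring, by linear_combination (1 / 4) * hs⟩

/-- A real quartic with distinct complex roots has an even number of non-real roots, in conjugate
pairs. -/
theorem hasConjRoots_of_nodup {χ : Fin 4 → ℝ}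
    (h : (quartic (Complex.ofRealHom ∘ χ)).roots.Nodup) :
    HasConjRoots 1 χ ∨ HasConjRoots (Equiv.swap 2 3) χ ∨
      HasConjRoots (Equiv.swap 0 1 * Equiv.swap 2 3) χ := by
  obtain ⟨x, rfl⟩ := exists_quadMul_eq χ
  obtain ⟨z₀, z₁, hs, hp⟩ := exists_complex_roots (x 0) (x 1)
  obtain ⟨z₂, z₃, hs', hp'⟩ := exists_complex_roots (x 2) (x 3)
  have hprod : quartic (Complex.ofRealHom ∘ quadMul x) =
      (({z₀, z₁, z₂, z₃} : Multiset ℂ).map fun z => X - C z).prod := by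
    rw [← map_quartic, quartic_quadMul]
    simp [hs, hs', hp, hp']
    ring
  rw [hprod, roots_multiset_prod_X_sub_C] at h
  simp only [Multiset.insert_eq_cons, Multiset.nodup_cons, Multiset.mem_cons,
    Multiset.mem_singleton, not_or, Multiset.nodup_singleton, and_true] at h
  obtain ⟨⟨h01, h02, h03⟩, ⟨h12, h13⟩, h23⟩ := h
  have hd : x 0 ^ 2 - 4 * x 1 ≠ 0 := by
    have : ((x 0 ^ 2 - 4 * x 1 : ℝ) : ℂ) = (z₀ - z₁) ^ 2 := by
      push_cast
      rw [hs, hp]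
      ring
    exact_mod_cast this ▸ pow_ne_zero 2 (sub_ne_zero.2 h01)
  have hd' : x 2 ^ 2 - 4 * x 3 ≠ 0 := by
    have : ((x 2 ^ 2 - 4 * x 3 : ℝ) : ℂ) = (z₂ - z₃) ^ 2 := by
      push_cast
      rw [hs', hp']
      ring
    exact_mod_cast this ▸ pow_ne_zero 2 (sub_ne_zero.2 h23)
  have hres : quadRes x ≠ 0 := by
    have : (quadRes x : ℂ) = (z₀ - z₂) * (z₀ - z₃) * (z₁ - z₂) * (z₁ - z₃) := by
      simp only [quadRes]
      push_cast
      rw [hs, hs', hp, hp']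
      ring
    have hne : (z₀ - z₂) * (z₀ - z₃) * (z₁ - z₂) * (z₁ - z₃) ≠ 0 := by
      simp [sub_eq_zero, h02, h03, h12, h13]
    exact_mod_cast this ▸ hne
  rcases lt_or_gt_of_ne hd with h | h <;> rcases lt_or_gt_of_ne hd' with h' | h'
  · exact Or.inr (Or.inr (hasConjRoots_quadMul_swap_swap h h' hres))
  -- The quadratic with real roots comes second here; exchanging the factors reduces to the
  -- labelling used in `hasConjRoots_quadMul_swap`.
  · have hx : quadMul x = quadMul ![x 2, x 3, x 0, x 1] := by
      ext k
      fin_cases k <;> simp [quadMul] <;> ring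
    rw [hx]
    refine Or.inr (Or.inl (hasConjRoots_quadMul_swap (by simpa using h') (by simpa using h) ?_))
    convert hres using 1
    simp [quadRes]
    ring
  · exact Or.inr (Or.inl (hasConjRoots_quadMul_swap h h' hres))
  · exact Or.inl (hasConjRoots_quadMul_one h h' hres)

/-- The Jacobian determinant of multiplication of monic quadratics is their resultant, so the map is
open where the factors are coprime. This gives open sets of quartics of each root type. -/
theorem isOpen_image_quadMul {W : Set (Fin 4 → ℝ)} (hW : IsOpen W) (hres : ∀ x ∈ W, quadRes x ≠ 0) :
    IsOpen (quadMul '' W) := by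
  rw [isOpen_iff_mem_nhds]
  rintro _ ⟨x, hx, rfl⟩
  let J : Matrix (Fin 4) (Fin 4) ℝ := !![0, -x 3, 0, -x 1; -x 3, -x 2, -x 1, -x 0;
    -x 2, -1, -x 0, -1; -1, 0, -1, 0]
  have hJ : J.det ≠ 0 := by
    convert hres x hx using 1
    simp [J, quadRes, Matrix.det_succ_row_zero, Fin.sum_univ_succ, Fin.succAbove]
    ring
  have hproj := fun i : Fin 4 => (ContinuousLinearMap.proj (R := ℝ) (φ := fun _ : Fin 4 => ℝ)
    i).hasStrictFDerivAt (x := x)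
  have hder : HasStrictFDerivAt quadMul (Matrix.toLin' J).toContinuousLinearMap x := by
    rw [hasStrictFDerivAt_pi']
    intro i
    fin_cases i
    · refine ((hproj 1).mul (hproj 3)).neg.congr_fderiv ?_
      ext y
      simp [J, dotProduct, Fin.sum_univ_four]
    · refine (((hproj 0).mul (hproj 3)).add ((hproj 1).mul (hproj 2))).neg.congr_fderiv ?_
      ext y
      simp [J, dotProduct, Fin.sum_univ_four]
      ring
    · refine (((hproj 1).add ((hproj 0).mul (hproj 2))).add (hproj 3)).neg.congr_fderiv ?_
      ext y
      simp [J, dotProduct, Fin.sum_univ_four]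
      ring
    · refine ((hproj 0).add (hproj 2)).neg.congr_fderiv ?_
      ext y
      simp [J, dotProduct, Fin.sum_univ_four]
      ring
  have hsurj : (Matrix.toLin' J).toContinuousLinearMap.range = ⊤ := by
    rw [LinearMap.range_eq_top]
    exact Matrix.mulVec_surjective_iff_isUnit.2
      ((Matrix.isUnit_iff_isUnit_det _).2 (isUnit_iff_ne_zero.2 hJ))
  rw [← hder.map_nhds_eq_of_surj hsurj]
  exact Filter.image_mem_map (hW.mem_nhds hx)

end Quadratics

/-! ### The parametrization as an embedding, and the three typical ranks -/

section TypicalRanks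

open Matrix Topology Filter

variable {n d : ℕ}

theorem hasDerivAt_moment {f : ℝ → MonomialExp (n + 3) d → ℝ} (hf : HasDerivAt f 0 0) (p : ℕ)
    (j : Fin (n + 3 + 1)) : HasDerivAt (fun s => moment (f s) p j) 0 0 := by
  simp only [moment, coeff_formOfCoeffs]
  split_ifs
  · simpa using (hasDerivAt_pi.1 hf _).div_const _
  · simpa using hasDerivAt_const _ _

theorem hasDerivAt_hankel_mulVec {f : ℝ → MonomialExp (n + 3) d → ℝ} (hf : HasDerivAt f 0 0)
    (y z : Fin 4 → ℝ) (p : Fin 4) :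
    HasDerivAt (fun s : ℝ => (hankel (f s) *ᵥ (y + s • z)) p) ((hankel (f 0) *ᵥ z) p) 0 := by
  simp only [mulVec, dotProduct]
  refine HasDerivAt.fun_sum fun q _ => ?_
  have h1 : HasDerivAt (fun s : ℝ => (y + s • z) q) (1 * z q) 0 :=
    ((hasDerivAt_id (0 : ℝ)).mul_const (z q)).const_add (y q)
  have h2 := (hasDerivAt_moment hf (p + q) 0).fun_mul h1
  simpa [hankel] using h2

/-- The parametrization is an immersion where the Hankel matrix is non-singular. -/
theorem injective_fderiv_secantParam (hd : 8 ≤ d) {P : Fin (n + 3 + 1) → Fin 4 → ℝ}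
    (hP : (hankel (secantParam d P)).det ≠ 0) :
    Function.Injective (fderiv ℝ (secantParam (K := ℝ) (n := n) d) P) := by
  rw [injective_iff_map_eq_zero]
  intro R hR
  have hline : HasDerivAt (fun s : ℝ => P + s • R) R 0 := by
    simpa using ((hasDerivAt_id (0 : ℝ)).smul_const R).const_add P
  have hdiff : HasFDerivAt (secantParam (K := ℝ) (n := n) d)
      (fderiv ℝ (secantParam (K := ℝ) (n := n) d) P) (P + (0 : ℝ) • R) := by
    rw [zero_smul, add_zero]
    exact ((contDiff_secantParam (𝕜 := ℝ)).differentiable (by simp) P).hasFDerivAt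
  have hf : HasDerivAt (fun s : ℝ => secantParam d (P + s • R)) 0 0 := by
    have := hdiff.comp_hasDerivAt (0 : ℝ) hline
    rwa [hR] at this
  have hf0 : secantParam d (P + (0 : ℝ) • R) = secantParam d P := by simp
  -- Along a direction `R` in the kernel of the derivative all moments are stationary.
  -- Differentiating the system "Hankel matrix times row `j` equals moments" leaves the Hankel
  -- matrix applied to `R j` equal to zero.
  have hsolve : ∀ (j : Fin (n + 3 + 1)) (g : ℝ → Fin 4 → ℝ), (∀ p, HasDerivAt (fun s => g s p) 0 0) →
      (∀ s : ℝ, hankel (secantParam d (P + s • R)) *ᵥ (P j + s • R j) = g s) → R j = 0 := by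
    intro j g hg hsg
    refine eq_zero_of_mulVec_eq_zero hP (funext fun p => ?_)
    have h1 := hasDerivAt_hankel_mulVec hf (P j) (R j) p
    simp only [hsg] at h1
    rw [hf0] at h1
    exact h1.unique (hg p)
  funext j
  by_cases h0 : j = 0
  · subst h0
    ext p
    have h1 := hasDerivAt_moment hf p 0
    have h2 : ∀ s : ℝ, moment (secantParam d (P + s • R)) p 0 = P 0 p + s * R 0 p := fun s => by
      rw [moment_secantParam_zero _ (by omega), recSeq_val]
      rfl
    simp only [h2] at h1
    have h3 : HasDerivAt (fun s : ℝ => P 0 p + s * R 0 p) (1 * R 0 p) 0 :=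
      ((hasDerivAt_id (0 : ℝ)).mul_const _).const_add _
    simpa using h3.unique h1
  by_cases h1 : j = 1
  · subst h1
    exact hsolve 1 _ (fun p => hasDerivAt_moment hf (p + 4) 0) fun s =>
      hankel_mulVec_charCoeffs hd (P + s • R)
  · exact hsolve j _ (fun p => hasDerivAt_moment hf p j) fun s =>
      hankel_mulVec_of_ne hd (P + s • R) h0 h1

theorem continuous_secantParam :
    Continuous (secantParam d : (Fin (n + 3 + 1) → Fin 4 → ℝ) → _) :=
  (contDiff_secantParam (𝕜 := ℝ)).continuous

theorem isOpen_setOf_paramOf_mem {V : Set (Fin (n + 3 + 1) → Fin 4 → ℝ)} (hV : IsOpen V) :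
    IsOpen {v : MonomialExp (n + 3) d → ℝ | (hankel v).det ≠ 0 ∧ paramOf v ∈ V} := by
  rw [isOpen_iff_mem_nhds]
  rintro v ⟨hv, hvV⟩
  filter_upwards [(continuous_det_hankel (𝕜 := ℝ)).continuousAt.eventually_ne hv,
    (continuousAt_paramOf hv).eventually (hV.mem_nhds hvV)] with v' h1 h2
  exact ⟨h1, h2⟩

/-- The inverse cuts out the image of `V` by conditions on the form alone. For open `V` these are
open conditions, so the image is open in the real cone. -/
theorem image_secantParam_eq (hd : 8 ≤ d) {V : Set (Fin (n + 3 + 1) → Fin 4 → ℝ)}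
    (hdet : ∀ P ∈ V, (hankel (secantParam d P)).det ≠ 0) :
    secantParam d '' V = realSecantCone (n + 3) d 4 ∩
      {v | (hankel v).det ≠ 0 ∧ paramOf v ∈ V} := by
  ext v
  constructor
  · rintro ⟨P, hP, rfl⟩
    refine ⟨secantParam_mem_realSecantCone P, hdet P hP, ?_⟩
    rwa [paramOf_secantParam hd (hdet P hP)]
  · rintro ⟨hv, hv', hvV⟩
    exact ⟨_, hvV, secantParam_paramOf_of_mem_realSecantCone hd hv hv'⟩

/-- `paramOf` is a left inverse, continuous where the Hankel determinant is nonzero. -/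
theorem isEmbedding_secantParam (hd : 8 ≤ d) {V : Set (Fin (n + 3 + 1) → Fin 4 → ℝ)}
    (hdet : ∀ P ∈ V, (hankel (secantParam d P)).det ≠ 0) :
    IsEmbedding (V.domRestrict (secantParam d)) := by
  let f : V → {v : MonomialExp (n + 3) d → ℝ // (hankel v).det ≠ 0} :=
    fun P => ⟨secantParam d P, hdet P P.2⟩
  let g : {v : MonomialExp (n + 3) d → ℝ // (hankel v).det ≠ 0} → Fin (n + 3 + 1) → Fin 4 → ℝ :=
    fun v => paramOf v.1
  have hf : Continuous f := (continuous_secantParam.comp continuous_subtype_val).subtype_mk _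
  have hg : Continuous g := continuous_iff_continuousAt.2 fun v =>
    (continuousAt_paramOf v.2).comp continuous_subtype_val.continuousAt
  have hgf : g ∘ f = Subtype.val := funext fun P => paramOf_secantParam hd (hdet P P.2)
  exact IsEmbedding.subtypeVal.comp (IsEmbedding.of_comp hf hg (hgf ▸ IsEmbedding.subtypeVal))

theorem isSmoothSubmanifold_image_secantParam (hd : 8 ≤ d)
    {V : Set (Fin (n + 3 + 1) → Fin 4 → ℝ)} (hV : IsOpen V)
    (hdet : ∀ P ∈ V, (hankel (secantParam d P)).det ≠ 0) :
    IsSmoothSubmanifold (4 * (n + 3 + 1)) (secantParam d '' V) := by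
  obtain ⟨L⟩ : Nonempty (EuclideanSpace ℝ (Fin (4 * (n + 3 + 1))) ≃L[ℝ]
      (Fin (n + 3 + 1) → Fin 4 → ℝ)) :=
    ⟨ContinuousLinearEquiv.ofFinrankEq (by simp [Module.finrank_pi_fintype, mul_comm])⟩
  rintro p hp
  refine ⟨Set.univ, L ⁻¹' V, secantParam d ∘ L, isOpen_univ, trivial, hV.preimage L.continuous,
    (contDiff_secantParam.comp L.contDiff).contDiffOn, fun x hx => ?_, ?_, ?_⟩
  · have hdiff := (contDiff_secantParam (𝕜 := ℝ) (d := d) (n := n)).differentiable (by simp) (L x)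
    rw [fderiv_comp x hdiff L.differentiableAt, L.fderiv]
    exact (injective_fderiv_secantParam hd (hdet _ hx)).comp L.injective
  · let e : (L ⁻¹' V) → V := fun x => ⟨L x, x.2⟩
    have he : IsEmbedding e := by
      refine IsEmbedding.of_comp ((L.continuous.comp continuous_subtype_val).subtype_mk _)
        continuous_subtype_val ?_
      exact L.toHomeomorph.isEmbedding.comp IsEmbedding.subtypeVal
    have hcomp : (L ⁻¹' V).domRestrict (secantParam d ∘ L) = V.domRestrict (secantParam d) ∘ e :=
      funext fun _ => rfl
    rw [hcomp]
    exact (isEmbedding_secantParam hd hdet).comp he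
  · rw [Set.image_comp, Set.image_preimage_eq _ L.surjective, Set.inter_univ]

theorem exists_param_mem {X : Set (Fin 4 → ℝ)} (hX : X.Nonempty) (hd : 8 ≤ d) :
    ∃ P : Fin (n + 3 + 1) → Fin 4 → ℝ, (hankel (secantParam d P)).det ≠ 0 ∧
      P 2 2 * P 3 3 - P 2 3 * P 3 2 ≠ 0 ∧ P 1 ∈ X := by
  obtain ⟨χ, hχ⟩ := hX
  have h2 : 2 % (n + 3 + 1) = 2 := Nat.mod_eq_of_lt (by omega)
  have h3 : 3 % (n + 3 + 1) = 3 := Nat.mod_eq_of_lt (by omega)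
  -- Initial moments `0, 0, 0, 1` make the Hankel matrix zero above the antidiagonal and one on it,
  -- hence invertible for every `χ`. The interpolating cubics `X ^ 2` and `X ^ 3` give the minor
  -- `1`.
  refine ⟨fun j => if (j : ℕ) = 0 then ![0, 0, 0, 1] else if (j : ℕ) = 1 then χ
    else if (j : ℕ) = 2 then ![0, 0, 1, 0] else ![0, 0, 0, 1], ?_, ?_, ?_⟩
  · set P : Fin (n + 3 + 1) → Fin 4 → ℝ := fun j => if (j : ℕ) = 0 then ![0, 0, 0, 1]
      else if (j : ℕ) = 1 then χ else if (j : ℕ) = 2 then ![0, 0, 1, 0] else ![0, 0, 0, 1]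
    have hH : hankel (secantParam d P) =
        Matrix.of fun p q : Fin 4 => recSeq χ ![0, 0, 0, 1] (p + q) := by
      ext p q
      exact moment_secantParam_zero P (by omega)
    rw [hH]
    simp [Matrix.det_succ_row_zero, Fin.sum_univ_succ, Fin.succAbove, recSeq]
  · simp [h2, h3]
  · simpa using hχ

theorem isTypicalRank_of_isOpen (hd : 8 ≤ d) {X : Set (Fin 4 → ℝ)} (hX : IsOpen X)
    (hne : X.Nonempty) {r : ℕ}
    (hr : ∀ P : Fin (n + 3 + 1) → Fin 4 → ℝ, (hankel (secantParam d P)).det ≠ 0 →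
      P 2 2 * P 3 3 - P 2 3 * P 3 2 ≠ 0 → P 1 ∈ X →
        HasSymmRank d (formOfCoeffs (secantParam d P)) r) :
    IsTypicalRank (n + 3) d 4 r := by
  let V : Set (Fin (n + 3 + 1) → Fin 4 → ℝ) := {P | (hankel (secantParam d P)).det ≠ 0 ∧
      P 2 2 * P 3 3 - P 2 3 * P 3 2 ≠ 0 ∧ P 1 ∈ X}
  have hV : IsOpen V := by
    refine IsOpen.inter ?_ (IsOpen.inter ?_ ?_)
    · exact isOpen_ne.preimage (continuous_det_hankel.comp continuous_secantParam)
    · exact isOpen_ne.preimage (f := fun P : Fin (n + 3 + 1) → Fin 4 → ℝ =>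
        P 2 2 * P 3 3 - P 2 3 * P 3 2) (by fun_prop)
    · exact hX.preimage (continuous_apply 1)
  have hdet : ∀ P ∈ V, (hankel (secantParam d P)).det ≠ 0 := fun P hP => hP.1
  obtain ⟨P₀, hP₀⟩ := exists_param_mem (n := n) hne hd
  refine ⟨secantParam d '' V, ⟨_, P₀, hP₀, rfl⟩, ⟨_, isOpen_setOf_paramOf_mem hV,
    image_secantParam_eq hd hdet⟩, isSmoothSubmanifold_image_secantParam hd hV hdet, ?_⟩
  rintro _ ⟨P, hP, rfl⟩
  exact hr P hP.1 hP.2.1 hP.2.2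

theorem isTypicalRank_of_quadMul (hd : 8 ≤ d) {W : Set (Fin 4 → ℝ)} (hW : IsOpen W)
    (hne : W.Nonempty) (hres : ∀ x ∈ W, quadRes x ≠ 0) {r : ℕ} {σ : Equiv.Perm (Fin 4)}
    (hσ : ∀ x ∈ W, HasConjRoots σ (quadMul x))
    (hr : ∀ P : Fin (n + 3 + 1) → Fin 4 → ℝ, (hankel (secantParam d P)).det ≠ 0 →
      P 2 2 * P 3 3 - P 2 3 * P 3 2 ≠ 0 → HasConjRoots σ (P 1) →
        HasSymmRank d (formOfCoeffs (secantParam d P)) r) :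
    IsTypicalRank (n + 3) d 4 r := by
  refine isTypicalRank_of_isOpen hd (isOpen_image_quadMul hW hres) (hne.image _)
    fun P h1 h2 h3 => hr P h1 h2 ?_
  obtain ⟨x, hx, hxP⟩ := h3
  exact hxP ▸ hσ x hx

theorem continuous_quadRes : Continuous quadRes := by
  unfold quadRes
  fun_prop

theorem isTypicalRank_four (hd : 8 ≤ d) : IsTypicalRank (n + 3) d 4 4 := by
  -- The witness is `(X ^ 2 - 1) * (X ^ 2 - 4)`.
  refine isTypicalRank_of_quadMul hd (W := {x | 0 < x 0 ^ 2 - 4 * x 1} ∩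
    ({x | 0 < x 2 ^ 2 - 4 * x 3} ∩ {x | quadRes x ≠ 0})) ?_ ⟨![0, -1, 0, -4], ?_⟩
    (fun x hx => hx.2.2) (fun x hx => hasConjRoots_quadMul_one hx.1 hx.2.1 hx.2.2)
    fun P h1 h2 => (hasSymmRank_secantParam hd h1 h2).1
  · exact (isOpen_lt (by fun_prop) (by fun_prop)).inter
      ((isOpen_lt (by fun_prop) (by fun_prop)).inter (isOpen_ne.preimage continuous_quadRes))
  · simp [quadRes]
    norm_num

theorem isTypicalRank_add_two (hd : 8 ≤ d) : IsTypicalRank (n + 3) d 4 (d + 2) := by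
  -- The witness is `(X ^ 2 - 1) * (X ^ 2 + 1)`.
  refine isTypicalRank_of_quadMul hd (W := {x | 0 < x 0 ^ 2 - 4 * x 1} ∩
    ({x | x 2 ^ 2 - 4 * x 3 < 0} ∩ {x | quadRes x ≠ 0})) ?_ ⟨![0, -1, 0, 1], ?_⟩
    (fun x hx => hx.2.2) (fun x hx => hasConjRoots_quadMul_swap hx.1 hx.2.1 hx.2.2)
    fun P h1 h2 => (hasSymmRank_secantParam hd h1 h2).2.1
  · exact (isOpen_lt (by fun_prop) (by fun_prop)).inter
      ((isOpen_lt (by fun_prop) (by fun_prop)).inter (isOpen_ne.preimage continuous_quadRes))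
  · simp [quadRes]
    norm_num

theorem isTypicalRank_two_mul (hd : 8 ≤ d) : IsTypicalRank (n + 3) d 4 (2 * d) := by
  -- The witness is `(X ^ 2 + 1) * (X ^ 2 + 4)`.
  refine isTypicalRank_of_quadMul hd (W := {x | x 0 ^ 2 - 4 * x 1 < 0} ∩
    ({x | x 2 ^ 2 - 4 * x 3 < 0} ∩ {x | quadRes x ≠ 0})) ?_ ⟨![0, 1, 0, 4], ?_⟩
    (fun x hx => hx.2.2) (fun x hx => hasConjRoots_quadMul_swap_swap hx.1 hx.2.1 hx.2.2)
    fun P h1 h2 => (hasSymmRank_secantParam hd h1 h2).2.2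
  · exact (isOpen_lt (by fun_prop) (by fun_prop)).inter
      ((isOpen_lt (by fun_prop) (by fun_prop)).inter (isOpen_ne.preimage continuous_quadRes))
  · simp [quadRes]
    norm_num

end TypicalRanks

/-! ### A full-dimensional piece is not contained in the degenerate locus -/

section Dimension

open Topology Filter

/-- Some linear projection of a non-empty `N`-dimensional submanifold to `ℝ ^ N` contains a
non-empty open set. -/
theorem IsSmoothSubmanifold.exists_projection_mem_nhds {E : Type*} [NormedAddCommGroup E]
    [NormedSpace ℝ E] [FiniteDimensional ℝ E] {N : ℕ} {U : Set E} (hU : IsSmoothSubmanifold N U)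
    (hne : U.Nonempty) :
    ∃ (L : E →ₗ[ℝ] (Fin N → ℝ)) (y : Fin N → ℝ), L '' U ∈ 𝓝 y := by
  obtain ⟨p, hp⟩ := hne
  obtain ⟨O, V, φ, -, hpO, hV, hφ, hinj, -, himg⟩ := hU p hp
  obtain ⟨x, hx, -⟩ : p ∈ φ '' V := himg ▸ ⟨hp, hpO⟩
  -- The projection is a linear left inverse of the derivative at one point; composed with the chart
  -- it is a local submersion, hence open there.
  obtain ⟨g, hg⟩ := LinearMap.exists_leftInverse_of_injective
    (fderiv ℝ φ x : EuclideanSpace ℝ (Fin N) →ₗ[ℝ] E) (LinearMap.ker_eq_bot.2 (hinj x hx))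
  let ε := (EuclideanSpace.equiv (Fin N) ℝ)
  let L : E →L[ℝ] (Fin N → ℝ) := ε.toContinuousLinearMap.comp g.toContinuousLinearMap
  have hder : HasStrictFDerivAt φ (fderiv ℝ φ x) x :=
    (hφ.contDiffAt (hV.mem_nhds hx)).hasStrictFDerivAt (by simp)
  have hcomp : HasStrictFDerivAt (L ∘ φ) (L.comp (fderiv ℝ φ x)) x :=
    L.hasStrictFDerivAt.comp x hder
  have hsurj : (L.comp (fderiv ℝ φ x)).range = ⊤ := by
    rw [LinearMap.range_eq_top]
    intro y
    refine ⟨ε.symm y, ?_⟩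
    have := LinearMap.congr_fun hg (ε.symm y)
    change ε (g (fderiv ℝ φ x (ε.symm y))) = y
    rw [show g (fderiv ℝ φ x (ε.symm y)) = ε.symm y from this, ε.apply_symm_apply]
  refine ⟨L, (L ∘ φ) x, ?_⟩
  rw [← hcomp.map_nhds_eq_of_surj hsurj]
  refine mem_of_superset (image_mem_map (hV.mem_nhds hx)) ?_
  rw [Set.image_comp, himg]
  exact Set.image_mono Set.inter_subset_left

/-- `N` elements of a polynomial ring in `N` variables and a further non-zero element `Q` satisfy a
relation that remains non-trivial at `Q = 0`. -/
theorem exists_relation_coeff_zero_ne_zero {σ K : Type} [Fintype σ] [Field K] {N : ℕ}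
    (hN : Fintype.card σ = N) (Y : Fin N → MvPolynomial σ K) {Q : MvPolynomial σ K} (hQ : Q ≠ 0) :
    ∃ p : Polynomial (MvPolynomial (Fin N) K), p.coeff 0 ≠ 0 ∧
      p.eval₂ (MvPolynomial.aeval Y : MvPolynomial (Fin N) K →ₐ[K] MvPolynomial σ K).toRingHom Q
        = 0 := by
  have hdep : ¬ AlgebraicIndependent K (fun o : Option (Fin N) => o.elim Q Y) := by
    intro h
    have h1 := h.cardinalMk_le_trdeg
    rw [MvPolynomial.trdeg_of_isDomain, Cardinal.lift_id, Cardinal.mk_fintype, Cardinal.mk_fintype,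
      Fintype.card_option, Fintype.card_fin, hN] at h1
    exact absurd (Nat.cast_le.1 h1) (by omega)
  rw [algebraicIndependent_iff] at hdep
  push Not at hdep
  obtain ⟨f, hf, hf0⟩ := hdep
  have heval : ∀ g : MvPolynomial (Option (Fin N)) K,
      (MvPolynomial.optionEquivLeft K (Fin N) g).eval₂ (MvPolynomial.aeval Y :
        MvPolynomial (Fin N) K →ₐ[K] MvPolynomial σ K).toRingHom Q =
      MvPolynomial.aeval (fun o : Option (Fin N) => o.elim Q Y) g := by
    intro g
    induction g using MvPolynomial.induction_on with
    | C a => simp [MvPolynomial.algebraMap_eq]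
    | add p q hp hq => rw [map_add, Polynomial.eval₂_add, hp, hq, map_add]
    | mul_X p o hp =>
      rw [map_mul, Polynomial.eval₂_mul, hp, map_mul]
      cases o <;> simp
  set p₀ := MvPolynomial.optionEquivLeft K (Fin N) f with hp₀
  have hne : p₀ ≠ 0 := by simpa [hp₀] using hf0
  -- Transcendence degree `N` gives a relation among the `N + 1` elements. Cancelling the highest
  -- power of `Q` that divides it makes its constant term nonzero.
  obtain ⟨q, hq, hndvd⟩ := Polynomial.exists_eq_pow_rootMultiplicity_mul_and_not_dvd p₀ hne 0
  refine ⟨q, ?_, ?_⟩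
  · rwa [map_zero, sub_zero, Polynomial.X_dvd_iff] at hndvd
  · have h1 := heval f
    rw [← hp₀, hf, hq, Polynomial.eval₂_mul, Polynomial.eval₂_pow, map_zero, sub_zero,
      Polynomial.eval₂_X] at h1
    exact (mul_eq_zero.1 h1).resolve_left (pow_ne_zero _ hQ)

variable {n d : ℕ}

/-- Complex weights are absorbed into the forms by `d`-th roots. With four summands, only the `4 *
(m + 1)` coefficients of the forms remain, which is the number of variables in the transcendence
degree count. -/
theorem exists_powerSum_one_of_isSumOfPowers {m s : ℕ} (hd : d ≠ 0) {v : MonomialExp m d → ℂ}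
    (hv : IsSumOfPowers d s (formOfCoeffs v)) :
    ∃ a : Fin s → Fin (m + 1) → ℂ, v = powerSum d 1 a := by
  obtain ⟨w, a, rfl⟩ := isSumOfPowers_formOfCoeffs_iff.1 hv
  choose r hr using fun i => IsAlgClosed.exists_pow_nat_eq (w i) (Nat.pos_of_ne_zero hd)
  refine ⟨fun i j => r i * a i j, ?_⟩
  ext α
  simp only [powerSum, mul_pow, Finset.prod_mul_distrib, Finset.prod_pow_eq_pow_sum, α.sum_eq, hr,
    Pi.one_apply, one_mul]

/-- The determinant of the Hankel matrix of a generic sum of four powers. -/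
noncomputable def genericDet (n d : ℕ) : MvPolynomial (Fin 4 × Fin (n + 3 + 1)) ℂ :=
  (Matrix.of fun p q : Fin 4 => ∑ i : Fin 4, (MvPolynomial.X (i, 0) ^ (d - 1 - (p + q : ℕ)) *
    MvPolynomial.X (i, 1) ^ (p + q : ℕ) * MvPolynomial.X (i, 0))).det

theorem eval_genericDet (hd : 8 ≤ d) (a : Fin 4 → Fin (n + 3 + 1) → ℂ) :
    MvPolynomial.eval (fun x => a x.1 x.2) (genericDet n d) = (hankel (powerSum d 1 a)).det := by
  rw [genericDet, RingHom.map_det]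
  congr 1
  ext p q
  rw [hankel, Matrix.of_apply, moment_powerSum 1 a (by omega)]
  simp

theorem genericDet_ne_zero (hd : 8 ≤ d) : genericDet n d ≠ 0 := by
  intro h
  -- At points with coordinate `x_1` equal to `0, 1, 2, 3` and all others `1`, the determinant is
  -- the square of a nonzero Vandermonde determinant.
  have h1 := eval_genericDet hd fun (i : Fin 4) (j : Fin (n + 3 + 1)) =>
    if j = 1 then ((i : ℕ) : ℂ) else 1
  rw [h, map_zero, hankel_powerSum hd, Matrix.det_mul, Matrix.det_mul, Matrix.det_diagonal,
    Matrix.det_transpose] at h1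
  have hV : (Matrix.vandermonde fun i : Fin 4 => ((i : ℕ) : ℂ)).det ≠ 0 :=
    Matrix.det_vandermonde_ne_zero_iff.2 fun i j hij => Fin.ext (by exact_mod_cast hij)
  rw [Matrix.vandermonde_eq_projVandermonde] at hV
  have h01 : (0 : Fin (n + 3 + 1)) ≠ 1 := by simp
  simp only [if_true, if_neg h01, Pi.one_apply, one_pow, mul_one, Finset.prod_const_one] at h1
  exact mul_ne_zero hV hV h1.symm

theorem continuous_eval₂_hankel {N : ℕ} (c : Fin N → MonomialExp (n + 3) d → ℂ)
    (p : Polynomial (MvPolynomial (Fin N) ℂ)) :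
    Continuous fun v : MonomialExp (n + 3) d → ℂ =>
      p.eval₂ (MvPolynomial.eval fun k => ∑ α, c k α * v α) (hankel v).det := by
  simp only [Polynomial.eval₂_eq_sum_range]
  refine continuous_finsetSum _ fun k _ => Continuous.mul ?_ (continuous_det_hankel.pow k)
  refine (MvPolynomial.continuous_eval _).comp ?_
  exact continuous_pi fun k => continuous_finsetSum _ fun α _ =>
    continuous_const.mul (continuous_apply α)

/-- Any `4 * (m + 1)` linear functions on the secant cone satisfy a non-trivial polynomial relation
on the locus where the determinant of the Hankel matrix vanishes. -/
theorem exists_relation_secantCone (hd : 8 ≤ d)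
    (c : Fin (4 * (n + 3 + 1)) → MonomialExp (n + 3) d → ℂ) :
    ∃ p : Polynomial (MvPolynomial (Fin (4 * (n + 3 + 1))) ℂ), p.coeff 0 ≠ 0 ∧
      ∀ v ∈ secantCone (n + 3) d 4,
        p.eval₂ (MvPolynomial.eval fun k => ∑ α, c k α * v α) (hankel v).det = 0 := by
  let G : MonomialExp (n + 3) d → MvPolynomial (Fin 4 × Fin (n + 3 + 1)) ℂ :=
    powerSum d 1 fun i j => MvPolynomial.X (i, j)
  have hG : ∀ (a : Fin 4 → Fin (n + 3 + 1) → ℂ) (α : MonomialExp (n + 3) d),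
      MvPolynomial.eval (fun x => a x.1 x.2) (G α) = powerSum d 1 a α := by
    intro a α
    rw [map_powerSum]
    congr 1
    · ext; simp
    · ext; simp
  obtain ⟨p, hp0, hp⟩ := exists_relation_coeff_zero_ne_zero (by simp)
    (fun k => ∑ α, MvPolynomial.C (c k α) * G α) (genericDet_ne_zero hd)
  refine ⟨p, hp0, fun v hv => closure_minimal ?_
    (isClosed_eq (continuous_eval₂_hankel c p) continuous_const) hv⟩
  intro v hv
  obtain ⟨a, rfl⟩ := exists_powerSum_one_of_isSumOfPowers (by omega) hv
  have h1 := congrArg (MvPolynomial.eval fun x : Fin 4 × Fin (n + 3 + 1) => a x.1 x.2) hp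
  rw [Polynomial.hom_eval₂, map_zero, eval_genericDet hd] at h1
  rw [Set.mem_ofPred_eq, ← h1]
  congr 1
  refine MvPolynomial.ringHom_ext (fun r => by simp [MvPolynomial.algebraMap_eq]) fun k => ?_
  simp [hG]

theorem LinearMap.apply_eq_sum_single {κ : Type*} [Fintype κ] [DecidableEq κ] {N : ℕ}
    (L : (κ → ℝ) →ₗ[ℝ] (Fin N → ℝ)) (v : κ → ℝ) (k : Fin N) :
    L v k = ∑ α, L (Pi.single α 1) k * v α := by
  conv_lhs => rw [← Finset.univ_sum_single v, map_sum, Finset.sum_apply]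
  refine Finset.sum_congr rfl fun α _ => ?_
  have : (Pi.single α (v α) : κ → ℝ) = v α • Pi.single α 1 := by
    rw [← Pi.single_smul, smul_eq_mul, mul_one]
  rw [this, map_smul, Pi.smul_apply, smul_eq_mul, mul_comm]

/-- If the determinant vanished on `U`, the relation of `exists_relation_secantCone` would reduce to
its nonzero constant term. That polynomial in `4 * (m + 1)` variables would vanish on a linear
projection of `U` that contains an open set. -/
theorem exists_det_hankel_ne_zero (hd : 8 ≤ d) {U : Set (MonomialExp (n + 3) d → ℝ)}
    (hne : U.Nonempty) (hUS : U ⊆ realSecantCone (n + 3) d 4)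
    (hU : IsSmoothSubmanifold (4 * (n + 3 + 1)) U) : ∃ v ∈ U, (hankel v).det ≠ 0 := by
  classical
  by_contra! hzero
  obtain ⟨L, y, hy⟩ := hU.exists_projection_mem_nhds hne
  obtain ⟨p, hp0, hrel⟩ := exists_relation_secantCone hd
    fun k (α : MonomialExp (n + 3) d) => (L (Pi.single α 1) k : ℂ)
  refine hp0 ?_
  obtain ⟨δ, hδ, hball⟩ := Metric.mem_nhds_iff.1 hy
  -- A product of infinite sets suffices to force a complex polynomial to be zero, so a real box is
  -- enough.
  refine MvPolynomial.funext_set (fun k => Complex.ofReal '' Metric.ball (y k) δ)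
    (fun k => ?_) fun x hx => ?_
  · refine Set.Infinite.image Complex.ofReal_injective.injOn ?_
    exact infinite_of_mem_nhds (y k) (Metric.ball_mem_nhds _ hδ)
  · choose z hz hzx using fun k => hx k (Set.mem_univ k)
    have hzy : z ∈ Metric.ball y δ := by
      rw [Metric.mem_ball, dist_pi_lt_iff hδ]
      exact fun k => hz k
    obtain ⟨v, hv, hLv⟩ := hball hzy
    have h1 := hrel _ (hUS hv)
    have h2 : (hankel fun α => (v α : ℂ)).det = 0 := by
      have := det_hankel_map Complex.ofRealHom v
      rw [hzero v hv, map_zero] at this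
      exact this
    have h3 : (fun k => ∑ α, (L (Pi.single α 1) k : ℂ) * (v α : ℂ)) = x := by
      ext k
      rw [← hzx k, ← hLv, L.apply_eq_sum_single v k]
      push_cast
      rfl
    rw [h2, Polynomial.eval₂_at_zero, h3] at h1
    rw [map_zero, h1]

/-- A generic small perturbation of a parameter has a quartic with distinct roots and spanning
points. -/
theorem exists_generic_param {P : Fin (n + 3 + 1) → Fin 4 → ℝ}
    {W : Set (Fin (n + 3 + 1) → Fin 4 → ℝ)} (hW : W ∈ 𝓝 P) :
    ∃ P' ∈ W, P' 2 2 * P' 3 3 - P' 2 3 * P' 3 2 ≠ 0 ∧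
      (quartic (Complex.ofRealHom ∘ P' 1)).roots.Nodup := by
  have h2 : 2 % (n + 3 + 1) = 2 := Nat.mod_eq_of_lt (by omega)
  have h3 : 3 % (n + 3 + 1) = 3 := Nat.mod_eq_of_lt (by omega)
  -- Moving by `ε` along `R` shifts the constant coefficient of row `1` and both diagonal entries of
  -- the minor by `ε`. Each condition then fails for finitely many `ε` only.
  let R : Fin (n + 3 + 1) → Fin 4 → ℝ := fun j => if (j : ℕ) = 1 then ![1, 0, 0, 0]
    else if (j : ℕ) = 2 then ![0, 0, 1, 0] else if (j : ℕ) = 3 then ![0, 0, 0, 1] else 0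
  have hR1 : R 1 = ![1, 0, 0, 0] := by simp [R]
  have hR2 : R 2 = ![0, 0, 1, 0] := by simp [R, h2]
  have hR3 : R 3 = ![0, 0, 0, 1] := by simp [R, h3]
  have hlim : Tendsto (fun ε : ℝ => P + ε • R) (𝓝[≠] 0) (𝓝 P) := by
    have : Continuous fun ε : ℝ => P + ε • R := by fun_prop
    have := this.tendsto 0
    rw [zero_smul, add_zero] at this
    exact this.mono_left nhdsWithin_le_nhds
  have hfin1 : {ε : ℝ | (P 2 2 + ε) * (P 3 3 + ε) - P 2 3 * P 3 2 = 0}.Finite := by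
    let q : Polynomial ℝ := (Polynomial.X + Polynomial.C (P 2 2)) *
      (Polynomial.X + Polynomial.C (P 3 3)) - Polynomial.C (P 2 3 * P 3 2)
    have hq : q ≠ 0 := by
      intro h
      -- At this point both linear factors are at least `1`, and their product exceeds `P 2 3 * P 3
      -- 2`.
      have := congrArg (Polynomial.eval (1 + |P 2 2| + |P 3 3| + |P 2 3 * P 3 2|)) h
      simp only [q, Polynomial.eval_sub, Polynomial.eval_mul, Polynomial.eval_add,
        Polynomial.eval_X, Polynomial.eval_C, Polynomial.eval_zero] at this
      have ha := neg_abs_le (P 2 2)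
      have hb := neg_abs_le (P 3 3)
      have hc := le_abs_self (P 2 3 * P 3 2)
      nlinarith [abs_nonneg (P 2 2), abs_nonneg (P 3 3), abs_nonneg (P 2 3 * P 3 2)]
    refine (Polynomial.finite_setOfPred_isRoot hq).subset fun ε hε => ?_
    simp only [Set.mem_ofPred_eq] at hε
    simp only [Set.mem_ofPred_eq, Polynomial.IsRoot.def, q, Polynomial.eval_sub,
      Polynomial.eval_mul, Polynomial.eval_add, Polynomial.eval_X, Polynomial.eval_C]
    linarith
  have hfin2 : {ε : ℝ | ¬ (quartic (Complex.ofRealHom ∘ P 1 + Pi.single 0 (ε : ℂ))).roots.Nodup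
      }.Finite :=
    (finite_setOf_not_nodup_roots (Complex.ofRealHom ∘ P 1)).preimage
      Complex.ofReal_injective.injOn
  obtain ⟨ε, hε, h1, h2⟩ := ((hlim.eventually hW).and ((eventually_notMem_of_finite hfin1).and
    (eventually_notMem_of_finite hfin2))).exists
  refine ⟨P + ε • R, hε, ?_, ?_⟩
  · simpa [hR2, hR3] using h1
  · have : Complex.ofRealHom ∘ (P + ε • R) 1 = Complex.ofRealHom ∘ P 1 + Pi.single 0 (ε : ℂ) := by
      ext k
      fin_cases k <;> simp [hR1, Matrix.vecHead, Matrix.vecTail]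
    rw [this]
    simpa using h2

end Dimension

theorem mainTheorem5 (m d : ℕ) (hm : 3 ≤ m) (hd : 8 ≤ d) :
    {r : ℕ | IsTypicalRank m d 4 r} = {4, d + 2, 2 * d} := by
  obtain ⟨n, rfl⟩ := Nat.exists_eq_add_of_le' hm
  ext r
  constructor
  · rintro ⟨U, hne, ⟨O, hO, rfl⟩, hU, hr⟩
    obtain ⟨v, hv, hdet⟩ := exists_det_hankel_ne_zero hd hne Set.inter_subset_left hU
    have hvP := secantParam_paramOf_of_mem_realSecantCone hd hv.1 hdet
    have hopen : IsOpen {P : Fin (n + 3 + 1) → Fin 4 → ℝ |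
        secantParam d P ∈ O ∧ (hankel (secantParam d P)).det ≠ 0} :=
      (hO.preimage continuous_secantParam).inter
        (isOpen_ne.preimage (continuous_det_hankel.comp continuous_secantParam))
    -- The rank is constant on the open piece, so it can be computed at a generic parameter near
    -- that of `v` instead of at `v` itself.
    obtain ⟨P, ⟨hPO, hPdet⟩, hPq, hPn⟩ := exists_generic_param (hopen.mem_nhds
      (show _ ∧ _ by rw [hvP]; exact ⟨hv.2, hdet⟩))
    have hrank := hr _ ⟨secantParam_mem_realSecantCone P, hPO⟩
    have htypes := hasSymmRank_secantParam hd hPdet hPq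
    rcases hasConjRoots_of_nodup hPn with h | h | h
    · exact Or.inl (hrank.unique (htypes.1 h))
    · exact Or.inr (Or.inl (hrank.unique (htypes.2.1 h)))
    · exact Or.inr (Or.inr (hrank.unique (htypes.2.2 h)))
  · rintro (rfl | rfl | rfl)
    · exact isTypicalRank_four hd
    · exact isTypicalRank_add_two hd
    · exact isTypicalRank_two_mul hd
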